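/- Fix a finite set of unitary gates, each acting on finitely many qubits. A bipartite LOCC map $\Gamma$ on qubits has a circuit description of size at most $s$ if it is implemented by an $r$-round protocol, for some $r$, of the following kind. Party $A$ (resp. $B$) holds its input qubits and $t_A$ (resp. $t_B$) ancillas initialised to $|0\rangle$; both parties have access to a communication register of $c$ bits initialised to $0$. In each round $A$ applies a circuit (gates of the fixed set and computational-basis measurements) to its own qubits and the communication register, the register is measured in the computational basis, $B$ does the same on its side, and the register is measured again. The output consists of the first qubits of the two private registers. The total number of ancilla and communication-bit creations, gates and measurements is at most $s$. A family $\{\Gamma^\lambda\}_{\lambda\in\mathbb N_+}$ of LOCC maps is efficient if for some polynomial $p$ and all $\lambda$, $\Gamma^\lambda$ has a circuit description of size at most $p(\lambda)$. Let $\Phi^{\otimes m}$ be the state of $m$ EPR pairs and $F$ the (squared, Uhlmann) fidelity. For a bipartite state $\rho$, $E_D^\varepsilon(\rho)$ is the supremum of all $m$ for which some LOCC map $\Gamma$ satisfies $1-\langle\Phi^{\otimes m}|\Gamma(\rho)|\Phi^{\otimes m}\rangle\le\varepsilon$; $E_C^{\varepsilon}(\rho)$ is the infimum of all $N$ for which some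 LOCC map $\Gamma$ satisfies $1-F(\Gamma(\Phi^{\otimes N}),\rho)\le\varepsilon$; and $E(\rho)=\max\{H(A)_\rho,H(B)_\rho\}$ is the entanglement entropy in bits. For a family $\{\rho^\lambda\}$, a function $m:\mathbb N_+\to\mathbb N$ is a valid lower bound on $\hat E_D^{\varepsilon}(\{\rho^\lambda\})$ if there is an efficient family of LOCC maps $\Gamma^\lambda$ with $2m(\lambda)$-qubit output such that $1-\langle\Phi^{\otimes m(\lambda)}|\Gamma^\lambda(\rho^\lambda)|\Phi^{\otimes m(\lambda)}\rangle\le\varepsilon$ for all $\lambda$; a function $N:\mathbb N_+\to\mathbb N$ is a valid upper bound on $\hat E_C^{\varepsilon}(\{\rho^\lambda\})$ if there is an efficient family of LOCC maps $\Gamma^\lambda$ with $1-F(\Gamma^\lambda(\Phi^{\otimes N(\lambda)}),\rho^\lambda)\le\varepsilon$ for all $\lambda$. There is $\varepsilon_0>0$ such that for every finite gate set, every $0<\varepsilon\le\varepsilon_0$ and every $n:\mathbb N_+\to\mathbb N$ with $n(\lambda)/\log\lambda\to\infty$ as $\lambda\to\infty$ (for instance, every non-constant polynomial): 1. There is a family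 $\{\rho^\lambda\}_{\lambda\in\mathbb N_+}$ of bipartite pure states on $n(\lambda)+n(\lambda)$ qubits such that $E_D^{\varepsilon}(\rho^\lambda)=E(\rho^\lambda)=n(\lambda)$ for all $\lambda$, while every valid lower bound $m$ on $\hat E_D^{\varepsilon}(\{\rho^\lambda\})$ satisfies $m(\lambda)=0$ for all large enough $\lambda$. 2. There is a family $\{\sigma^\lambda\}_{\lambda\in\mathbb N_+}$ of bipartite pure product states on $n(\lambda)+n(\lambda)$ qubits, so that $E_C^{\delta}(\sigma^\lambda)=0$ for all $\delta\ge 0$ and all $\lambda$, such that for every valid upper bound $N$ on $\hat E_C^{\varepsilon}(\{\sigma^\lambda\})$ and every polynomially bounded $q:\mathbb N_+\to\mathbb N$, one has $N(\lambda)\ge q(\lambda)$ for all large enough $\lambda$. -/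

import Mathlib

open scoped Matrix Kronecker ComplexOrder MatrixOrder
open Filter

noncomputable section

namespace CompEnt

/-! ### States, partial traces, entropy, fidelity -/

/-- Computational basis labels of a register of `n` qubits. -/
abbrev Qubits (n : ℕ) : Type := Fin n → Bool

/-- A quantum state (density matrix) on the space with orthonormal basis `X`. -/
structure QState (X : Type) [Fintype X] [DecidableEq X] where
  mat : Matrix X X ℂ
  posSemidef : mat.PosSemidef
  trace_one : mat.trace = 1

/-- The rank-one operator `|ψ⟩⟨ψ|`. -/
def proj {X : Type} (ψ : X → ℂ) : Matrix X X ℂ := Matrix.vecMulVec ψ (star ψ)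

variable {X A B A' B' : Type}
  [Fintype X] [DecidableEq X] [Fintype A] [DecidableEq A] [Fintype B] [DecidableEq B]
  [Fintype A'] [DecidableEq A'] [Fintype B'] [DecidableEq B']

/-- `ρ = |ψ⟩⟨ψ|` for a vector `ψ`, which is a unit vector because `ρ` has trace one. -/
def QState.IsPure (ρ : QState X) : Prop := ∃ ψ : X → ℂ, ρ.mat = proj ψ

/-- `ρ` is a product state across the bipartition `A : B`. -/
def QState.IsProduct (ρ : QState (A × B)) : Prop :=
  ∃ (α : QState A) (β : QState B), ρ.mat = α.mat ⊗ₖ β.mat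

/-- The reduced state on `A`. -/
def QState.reduceA (ρ : QState (A × B)) : QState A where
  mat := ∑ b : B, ρ.mat.submatrix (fun a => (a, b)) (fun a => (a, b))
  posSemidef := Matrix.posSemidef_sum _ fun _ _ => ρ.posSemidef.submatrix _
  trace_one := by
    rw [← ρ.trace_one, Matrix.trace_sum, Matrix.trace, Fintype.sum_prod_type_right]
    rfl

/-- The reduced state on `B`. -/
def QState.reduceB (ρ : QState (A × B)) : QState B where
  mat := ∑ a : A, ρ.mat.submatrix (fun b => (a, b)) (fun b => (a, b))
  posSemidef := Matrix.posSemidef_sum _ fun _ _ => ρ.posSemidef.submatrix _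
  trace_one := by
    rw [← ρ.trace_one, Matrix.trace_sum, Matrix.trace, Fintype.sum_prod_type]
    rfl

/-- Von Neumann entropy, in bits. -/
def QState.entropy (ρ : QState X) : ℝ :=
  ∑ i, Real.negMulLog (ρ.posSemidef.isHermitian.eigenvalues i) / Real.log 2

/-- Entanglement entropy `E(ρ) = max {H(A), H(B)}`. -/
def entanglementEntropy (ρ : QState (A × B)) : ℝ :=
  max ρ.reduceA.entropy ρ.reduceB.entropy

/-- The (squared, Uhlmann) fidelity `F(ρ, σ) = (tr √(√σ ρ √σ))²`. -/
def fidelity (ρ σ : Matrix X X ℂ) : ℝ :=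
  (CFC.sqrt (CFC.sqrt σ * ρ * CFC.sqrt σ)).trace.re ^ 2

/-- The vector `|Φ⟩^{⊗ m}`, with `|Φ⟩ = (|00⟩ + |11⟩)/√2`; the first (second) qubit of
each pair belongs to the first (second) party. -/
def eprVec (m : ℕ) : Qubits m × Qubits m → ℂ :=
  fun x => ∏ i, if x.1 i = x.2 i then ((1 / Real.sqrt 2 : ℝ) : ℂ) else 0

/-- The state `Φ^{⊗ m}` of `m` EPR pairs. -/
def epr (m : ℕ) : Matrix (Qubits m × Qubits m) (Qubits m × Qubits m) ℂ := proj (eprVec m)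

/-! ### LOCC maps -/

/-- Maps on operators from the bipartite space `A : B` to the bipartite space `A' : B'`. -/
abbrev BiMap (A B A' B' : Type) : Type :=
  Matrix (A × B) (A × B) ℂ → Matrix (A' × B') (A' × B') ℂ

/-- `IsLOCC A' B' A B Γ`: the map `Γ` from `A : B` to `A' : B'` is implemented by a finite
interactive protocol. In a step `alice`, the first party performs an instrument with Kraus
operators `K x` on its system and announces the outcome `x`; the parties then continue with
a protocol `Λ x` that may depend on `x`. Since `Λ` is allowed to ignore (part of) `x`, this
covers arbitrary local channels followed by arbitrary classical messages. -/
inductive IsLOCC (A' B' : Type) [Fintype A'] [DecidableEq A'] [Fintype B'] [DecidableEq B'] :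
    (A B : Type) → [Fintype A] → [DecidableEq A] → [Fintype B] → [DecidableEq B] →
      BiMap A B A' B' → Prop
  | done : IsLOCC A' B' A' B' id
  | alice {A B A₁ : Type} [Fintype A] [DecidableEq A] [Fintype B] [DecidableEq B]
      [Fintype A₁] [DecidableEq A₁] {k : ℕ} (K : Fin k → Matrix A₁ A ℂ)
      (hK : ∑ x, (K x)ᴴ * K x = 1) (Λ : Fin k → BiMap A₁ B A' B')
      (hΛ : ∀ x, IsLOCC A' B' A₁ B (Λ x)) :
      IsLOCC A' B' A B fun ρ =>
        ∑ x, Λ x ((K x ⊗ₖ (1 : Matrix B B ℂ)) * ρ * (K x ⊗ₖ (1 : Matrix B B ℂ))ᴴ)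
  | bob {A B B₁ : Type} [Fintype A] [DecidableEq A] [Fintype B] [DecidableEq B]
      [Fintype B₁] [DecidableEq B₁] {k : ℕ} (K : Fin k → Matrix B₁ B ℂ)
      (hK : ∑ x, (K x)ᴴ * K x = 1) (Λ : Fin k → BiMap A B₁ A' B')
      (hΛ : ∀ x, IsLOCC A' B' A B₁ (Λ x)) :
      IsLOCC A' B' A B fun ρ =>
        ∑ x, Λ x (((1 : Matrix A A ℂ) ⊗ₖ K x) * ρ * ((1 : Matrix A A ℂ) ⊗ₖ K x)ᴴ)

/-! ### One-shot information-theoretic measures -/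

/-- Distillation error `1 - ⟨Φ^{⊗ m}| Γ(ρ) |Φ^{⊗ m}⟩`. -/
def distErr {m : ℕ} (Γ : BiMap A B (Qubits m) (Qubits m)) (ρ : QState (A × B)) : ℝ :=
  1 - (star (eprVec m) ⬝ᵥ (Γ ρ.mat *ᵥ eprVec m)).re

/-- Dilution error `1 - F(Γ(Φ^{⊗ n}), ρ)`. -/
def dilErr {n : ℕ} (Γ : BiMap (Qubits n) (Qubits n) A B) (ρ : QState (A × B)) : ℝ :=
  1 - fidelity (Γ (epr n)) ρ.mat

/-- One-shot distillable entanglement `E_D^ε(ρ)`. -/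
def oneShotED (ε : ℝ) (ρ : QState (A × B)) : ℕ∞ :=
  sSup {d : ℕ∞ | ∃ (m : ℕ) (Γ : BiMap A B (Qubits m) (Qubits m)),
    d = m ∧ IsLOCC (Qubits m) (Qubits m) A B Γ ∧ distErr Γ ρ ≤ ε}

/-- One-shot entanglement cost `E_C^ε(ρ)`. -/
def oneShotEC (ε : ℝ) (ρ : QState (A × B)) : ℕ∞ :=
  sInf {d : ℕ∞ | ∃ (n : ℕ) (Γ : BiMap (Qubits n) (Qubits n) A B),
    d = n ∧ IsLOCC A B (Qubits n) (Qubits n) Γ ∧ dilErr Γ ρ ≤ ε}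

/-! ### Circuits -/

/-- A finite set of unitary gates, each acting on finitely many qubits. -/
structure GateSet where
  Gate : Type
  fintypeGate : Fintype Gate
  arity : Gate → ℕ
  unitary : ∀ g, Matrix.unitaryGroup (Qubits (arity g)) ℂ

/-- An elementary operation on a set `W` of wires (qubits): a gate applied to an ordered tuple
of distinct wires, or the measurement of one wire in the computational basis. -/
inductive Op (G : GateSet) (W : Type) : Type
  | gate (g : G.Gate) (e : Fin (G.arity g) ↪ W) : Op G W
  | meas (w : W) : Op G W

/-- A circuit: a list of elementary operations, performed in order. -/
abbrev Circuit (G : GateSet) (W : Type) : Type := List (Op G W)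

variable {W V : Type} [Fintype W] [DecidableEq W] [Fintype V]

/-- Operators on the qubits labelled by `W`. -/
abbrev WireMat (W : Type) : Type := Matrix (W → Bool) (W → Bool) ℂ

/-- The operator `U` acting on the wires `e 0, e 1, …`, tensored with the identity on all other
wires. -/
def liftGate {k : ℕ} (U : Matrix (Qubits k) (Qubits k) ℂ) (e : Fin k ↪ W) : WireMat W :=
  Matrix.of fun x y => if ∀ w, (∀ j, e j ≠ w) → x w = y w then U (x ∘ e) (y ∘ e) else 0

/-- Measurement of the wires `e v` in the computational basis: the outcome stays in these
wires, and the coherences between different outcomes vanish. -/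
def measureWires (e : V → W) (ρ : WireMat W) : WireMat W :=
  Matrix.of fun x y => if x ∘ e = y ∘ e then ρ x y else 0

/-- The effect on all wires `W` of an operation on the wires `V`, placed inside `W` by `f`. -/
def Op.apply {G : GateSet} {V : Type} (f : V ↪ W) (ρ : WireMat W) : Op G V → WireMat W
  | .gate g e => liftGate (G.unitary g).1 (e.trans f) * ρ *
      (liftGate (G.unitary g).1 (e.trans f))ᴴ
  | .meas v => measureWires (fun _ : Unit => f v) ρ

/-- The effect of a circuit. -/
def Circuit.apply {G : GateSet} {V : Type} (f : V ↪ W) (C : Circuit G V) (ρ : WireMat W) :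
    WireMat W :=
  C.foldl (Op.apply f) ρ

/-! ### Circuit descriptions of LOCC maps -/

/-- A circuit description with inputs of `nA + nB` and outputs of `mA + mB` qubits. Each party
holds a private register (its input qubits followed by its ancillas); both have access to the
communication register of `c` bits. An element of `rounds` consists of the circuit of the first
party and that of the second party in this round. -/
structure LOCCCircuit (G : GateSet) (nA nB mA mB : ℕ) where
  tA : ℕ
  tB : ℕ
  c : ℕ
  rounds : List (Circuit G (Fin (nA + tA) ⊕ Fin c) × Circuit G (Fin (nB + tB) ⊕ Fin c))
  leA : mA ≤ nA + tA
  leB : mB ≤ nB + tB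

namespace LOCCCircuit

variable {G : GateSet} {nA nB mA mB : ℕ} (D : LOCCCircuit G nA nB mA mB)

/-- All wires: first private register, second private register, communication register. -/
abbrev Wires : Type := Fin (nA + D.tA) ⊕ (Fin (nB + D.tB) ⊕ Fin D.c)

/-- The wires accessible to the first party. -/
def embA : Fin (nA + D.tA) ⊕ Fin D.c ↪ D.Wires :=
  Function.Embedding.sumMap (Function.Embedding.refl _) Function.Embedding.inr

/-- The wires accessible to the second party. -/
def embB : Fin (nB + D.tB) ⊕ Fin D.c ↪ D.Wires := Function.Embedding.inr

/-- The communication wires. -/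
def comm (j : Fin D.c) : D.Wires := Sum.inr (Sum.inr j)

/-- The initial state: the input, with all ancillas and communication bits set to `0`. -/
def init (φ : Matrix (Qubits nA × Qubits nB) (Qubits nA × Qubits nB) ℂ) : WireMat D.Wires :=
  let zero (x : D.Wires → Bool) : Prop :=
    (∀ j, x (Sum.inl (Fin.natAdd nA j)) = false) ∧
    (∀ j, x (Sum.inr (Sum.inl (Fin.natAdd nB j))) = false) ∧ ∀ j, x (D.comm j) = false
  let inp (x : D.Wires → Bool) : Qubits nA × Qubits nB :=
    (fun i => x (Sum.inl (Fin.castAdd D.tA i)),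
      fun i => x (Sum.inr (Sum.inl (Fin.castAdd D.tB i))))
  Matrix.of fun x y => open Classical in if zero x ∧ zero y then φ (inp x) (inp y) else 0

/-- One round: the first party applies its circuit, the communication register is measured,
the second party applies its circuit, the communication register is measured. -/
def round (ρ : WireMat D.Wires)
    (R : Circuit G (Fin (nA + D.tA) ⊕ Fin D.c) × Circuit G (Fin (nB + D.tB) ⊕ Fin D.c)) :
    WireMat D.Wires :=
  measureWires D.comm (R.2.apply D.embB (measureWires D.comm (R.1.apply D.embA ρ)))

/-- The output: the first `mA` and the first `mB` qubits of the two private registers, all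
other wires being traced out. -/
def output (ρ : WireMat D.Wires) :
    Matrix (Qubits mA × Qubits mB) (Qubits mA × Qubits mB) ℂ :=
  let out (x : D.Wires → Bool) : Qubits mA × Qubits mB :=
    (fun i => x (Sum.inl (Fin.castLE D.leA i)),
      fun i => x (Sum.inr (Sum.inl (Fin.castLE D.leB i))))
  let sameRest (x y : D.Wires → Bool) : Prop :=
    (∀ j, mA ≤ j.val → x (Sum.inl j) = y (Sum.inl j)) ∧
    (∀ j, mB ≤ j.val → x (Sum.inr (Sum.inl j)) = y (Sum.inr (Sum.inl j))) ∧
    ∀ j, x (D.comm j) = y (D.comm j)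
  Matrix.of fun u v => ∑ x : D.Wires → Bool, ∑ y : D.Wires → Bool,
    open Classical in if out x = u ∧ out y = v ∧ sameRest x y then ρ x y else 0

/-- The map implemented by a circuit description. -/
def run : BiMap (Qubits nA) (Qubits nB) (Qubits mA) (Qubits mB) :=
  fun φ => D.output (D.rounds.foldl D.round (D.init φ))

/-- Total number of elementary operations: creation of ancillas and communication bits,
operations in the circuits, and measurements of the communication register. -/
def size : ℕ :=
  D.tA + D.tB + D.c +
    (D.rounds.map fun R => R.1.length + D.c + (R.2.length + D.c)).sum

end LOCCCircuit

/-- `Γ` is an LOCC map with a circuit description of size at most `s`. -/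
def HasCircuit (G : GateSet) {nA nB mA mB : ℕ}
    (Γ : BiMap (Qubits nA) (Qubits nB) (Qubits mA) (Qubits mB)) (s : ℕ) : Prop :=
  IsLOCC (Qubits mA) (Qubits mB) (Qubits nA) (Qubits nB) Γ ∧
    ∃ D : LOCCCircuit G nA nB mA mB, D.size ≤ s ∧ ∀ φ, D.run φ = Γ φ

/-- The family `Γ` of LOCC maps is efficient. -/
def EfficientLOCC (G : GateSet) {nA nB mA mB : ℕ+ → ℕ}
    (Γ : ∀ k, BiMap (Qubits (nA k)) (Qubits (nB k)) (Qubits (mA k)) (Qubits (mB k))) : Prop :=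
  ∃ p : Polynomial ℕ, ∀ k : ℕ+, HasCircuit G (Γ k) (p.eval (k : ℕ))

/-! ### Computational measures -/

/-- `m` is a valid lower bound on the computational one-shot distillable entanglement of `ρ`. -/
def IsLowerBoundED (G : GateSet) (ε : ℕ+ → ℝ) {nA nB : ℕ+ → ℕ}
    (ρ : ∀ k, QState (Qubits (nA k) × Qubits (nB k))) (m : ℕ+ → ℕ) : Prop :=
  ∃ Γ : ∀ k, BiMap (Qubits (nA k)) (Qubits (nB k)) (Qubits (m k)) (Qubits (m k)),
    EfficientLOCC G Γ ∧ ∀ k, distErr (Γ k) (ρ k) ≤ ε k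

/-- `n` is a valid upper bound on the computational one-shot entanglement cost of `ρ`. -/
def IsUpperBoundEC (G : GateSet) (ε : ℕ+ → ℝ) {mA mB : ℕ+ → ℕ}
    (ρ : ∀ k, QState (Qubits (mA k) × Qubits (mB k))) (n : ℕ+ → ℕ) : Prop :=
  ∃ Γ : ∀ k, BiMap (Qubits (n k)) (Qubits (n k)) (Qubits (mA k)) (Qubits (mB k)),
    EfficientLOCC G Γ ∧ ∀ k, dilErr (Γ k) (ρ k) ≤ ε k

/-- `f` is asymptotically less than `g`: `f k ≤ g k` for all large enough `k`. -/
def AsympLE (f g : ℕ+ → ℕ) : Prop := ∃ k₀ : ℕ+, ∀ k ≥ k₀, f k ≤ g k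

/-- `q` is bounded by a polynomial. -/
def PolyBounded (q : ℕ+ → ℕ) : Prop := ∃ p : Polynomial ℕ, ∀ k : ℕ+, q k ≤ p.eval (k : ℕ)

end CompEnt

end

open CompEnt

/-! The proof is a counting argument. Put `N = 2 ^ n` and attach signs `(-1) ^ f x` to the
superposition of `N` orthonormal product vectors. For distillation these are `|x⟩|x⟩`: the result is
maximally entangled, and a diagonal unitary of one party turns it into `n` EPR pairs. For dilution
they are `|x⟩|0⟩`: the result is a product state, so it costs no entanglement. There are `2 ^ N`
sign patterns but far fewer small circuits, and each circuit succeeds on a tiny fraction of the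
patterns only.

For a fixed LOCC map the success fidelity is a quadratic form `vᵀRv / N` in the sign vector `v`,
with `0 ≤ R ≤ 1`. Its trace is at most `N / 2`. In distillation, LOCC maps keep product states
separable, and a product vector overlaps `m` EPR pairs by at most `2 ^ (-m)`, so `tr R ≤ N * 2 ^
(-m)`, where `m ≥ 1`. In dilution, `R` comes from the output state, of trace one, and `n ≥ 1`. A
Gaussian linearisation bounds the exponential moment of the form (`sum_exp_quadForm_le`). Hence at
most `2 ^ N * exp (-N / 80)` sign patterns reach fidelity `9 / 10` (`card_signState_ge_le`).

A description of size `s` is a word of length `s` over an alphabet of size polynomial in `s` and the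
input length (`exists_finset_run`). For `s = 2 ^ (n / 4)` the number of maps is eventually below
`exp (N / 80)`, even after summing over the admissible `m` or the admissible numbers of EPR pairs. A
union bound leaves a sign pattern that defeats all of them. Since `n` grows faster than `log`, every
polynomial is eventually below `2 ^ (n / 4)`. -/

noncomputable section

namespace CompEnt

/-! ### Product vectors, rank-one operators and overlaps -/

section Vectors

variable {X Y A B A' B' : Type}

/-- The product vector `a ⊗ b`. -/
def prodVec (a : A → ℂ) (b : B → ℂ) : A × B → ℂ := fun p => a p.1 * b p.2

theorem proj_apply (ψ : X → ℂ) (x y : X) : proj ψ x y = ψ x * star (ψ y) := rfl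

theorem proj_conj [Fintype X] (K : Matrix Y X ℂ) (ψ : X → ℂ) :
    K * proj ψ * Kᴴ = proj (K *ᵥ ψ) := by
  rw [proj, proj, Matrix.mul_vecMulVec, Matrix.vecMulVec_mul, Matrix.star_mulVec]

theorem proj_posSemidef [Fintype X] (ψ : X → ℂ) : (proj ψ).PosSemidef :=
  Matrix.posSemidef_vecMulVec_self_star ψ

theorem trace_proj [Fintype X] (ψ : X → ℂ) : (proj ψ).trace = ψ ⬝ᵥ star ψ :=
  Matrix.trace_vecMulVec _ _

theorem proj_prodVec (a : A → ℂ) (b : B → ℂ) : proj (prodVec a b) = proj a ⊗ₖ proj b := by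
  ext ⟨i, j⟩ ⟨k, l⟩
  simp only [proj_apply, prodVec, Matrix.kroneckerMap_apply, star_mul']
  ring

theorem prodVec_dotProduct_star [Fintype A] [Fintype B] (a : A → ℂ) (b : B → ℂ) :
    prodVec a b ⬝ᵥ star (prodVec a b) = (a ⬝ᵥ star a) * (b ⬝ᵥ star b) := by
  simp only [dotProduct, prodVec, Pi.star_apply, star_mul', Fintype.sum_prod_type,
    Finset.sum_mul_sum]
  exact Finset.sum_congr rfl fun _ _ => Finset.sum_congr rfl fun _ _ => by ring

theorem kronecker_one_mulVec_prodVec [Fintype A] [Fintype B] [DecidableEq B]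
    (K : Matrix A' A ℂ) (a : A → ℂ) (b : B → ℂ) :
    (K ⊗ₖ (1 : Matrix B B ℂ)) *ᵥ prodVec a b = prodVec (K *ᵥ a) b := by
  ext ⟨i, j⟩
  simp [Matrix.mulVec, dotProduct, prodVec, Fintype.sum_prod_type, Matrix.one_apply,
    Finset.sum_mul, mul_assoc]

theorem one_kronecker_mulVec_prodVec [Fintype A] [Fintype B] [DecidableEq A]
    (K : Matrix B' B ℂ) (a : A → ℂ) (b : B → ℂ) :
    ((1 : Matrix A A ℂ) ⊗ₖ K) *ᵥ prodVec a b = prodVec a (K *ᵥ b) := by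
  ext ⟨i, j⟩
  simp only [Matrix.mulVec, dotProduct, prodVec, Fintype.sum_prod_type, Matrix.one_apply,
    Matrix.kroneckerMap_apply, ite_mul, one_mul, zero_mul, Finset.mul_sum]
  rw [Finset.sum_eq_single i (by intro k _ hk; simp [Ne.symm hk]) (by simp)]
  simp only [if_true]
  exact Finset.sum_congr rfl fun _ _ => by ring

/-- The quadratic form `⟨φ|M|φ⟩`. -/
noncomputable def overlap [Fintype X] (φ : X → ℂ) (M : Matrix X X ℂ) : ℂ :=
  star φ ⬝ᵥ (M *ᵥ φ)

theorem overlap_proj [Fintype X] (φ ψ : X → ℂ) :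
    overlap φ (proj ψ) = (Complex.normSq (star φ ⬝ᵥ ψ) : ℂ) := by
  rw [overlap, proj, Matrix.vecMulVec_mulVec, Complex.normSq_eq_conj_mul_self]
  have h : star ψ ⬝ᵥ φ = star (star φ ⬝ᵥ ψ) := by
    rw [Matrix.star_dotProduct]
  simp only [h, dotProduct_smul, op_smul_eq_smul, smul_eq_mul]
  rfl

theorem overlap_sum [Fintype X] {ι : Type} (s : Finset ι) (φ : X → ℂ) (M : ι → Matrix X X ℂ) :
    overlap φ (∑ i ∈ s, M i) = ∑ i ∈ s, overlap φ (M i) := by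
  simp only [overlap, Matrix.sum_mulVec, dotProduct_sum]

theorem overlap_smul [Fintype X] (φ : X → ℂ) (c : ℂ) (M : Matrix X X ℂ) :
    overlap φ (c • M) = c * overlap φ M := by
  simp only [overlap, Matrix.smul_mulVec, dotProduct_smul, smul_eq_mul]

end Vectors

/-! ### Structural properties of LOCC maps -/

section LOCC

variable {A B A' B' : Type} [Fintype A] [DecidableEq A] [Fintype B] [DecidableEq B]
  [Fintype A'] [DecidableEq A'] [Fintype B'] [DecidableEq B'] {Γ : BiMap A B A' B'}

theorem IsLOCC.isLinearMap (h : IsLOCC A' B' A B Γ) : IsLinearMap ℂ Γ := by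
  induction h with
  | done => exact ⟨fun _ _ => rfl, fun _ _ => rfl⟩
  | alice K hK Λ hΛ ih =>
    refine ⟨fun ρ σ => ?_, fun c ρ => ?_⟩
    · simp only [Matrix.mul_add, Matrix.add_mul, (ih _).map_add, Finset.sum_add_distrib]
    · simp only [Matrix.mul_smul, Matrix.smul_mul, (ih _).map_smul, Finset.smul_sum]
  | bob K hK Λ hΛ ih =>
    refine ⟨fun ρ σ => ?_, fun c ρ => ?_⟩
    · simp only [Matrix.mul_add, Matrix.add_mul, (ih _).map_add, Finset.sum_add_distrib]
    · simp only [Matrix.mul_smul, Matrix.smul_mul, (ih _).map_smul, Finset.smul_sum]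

theorem IsLOCC.posSemidef (h : IsLOCC A' B' A B Γ) :
    ∀ ρ : Matrix (A × B) (A × B) ℂ, ρ.PosSemidef → (Γ ρ).PosSemidef := by
  induction h with
  | done => exact fun _ h => h
  | alice K hK Λ hΛ ih =>
    exact fun ρ hρ => Matrix.posSemidef_sum _ fun x _ =>
      ih x _ (hρ.mul_mul_conjTranspose_same _)
  | bob K hK Λ hΛ ih =>
    exact fun ρ hρ => Matrix.posSemidef_sum _ fun x _ =>
      ih x _ (hρ.mul_mul_conjTranspose_same _)

theorem sum_trace_conj {X Y : Type} [Fintype X] [DecidableEq X] [Fintype Y] {k : ℕ}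
    (K : Fin k → Matrix Y X ℂ) (hK : ∑ x, (K x)ᴴ * K x = 1) (ρ : Matrix X X ℂ) :
    ∑ x, (K x * ρ * (K x)ᴴ).trace = ρ.trace := by
  simp_rw [Matrix.trace_mul_comm _ (_ᴴ), ← Matrix.mul_assoc, ← Matrix.trace_sum,
    ← Finset.sum_mul, hK, Matrix.one_mul]

theorem IsLOCC.trace_eq (h : IsLOCC A' B' A B Γ) :
    ∀ ρ : Matrix (A × B) (A × B) ℂ, (Γ ρ).trace = ρ.trace := by
  induction h with
  | done => exact fun _ => rfl
  | alice K hK Λ hΛ ih =>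
    intro ρ
    simp only [Matrix.trace_sum, ih]
    refine sum_trace_conj _ ?_ ρ
    simp only [Matrix.conjTranspose_kronecker, ← Matrix.mul_kronecker_mul,
      Matrix.conjTranspose_one, Matrix.mul_one]
    rw [← Matrix.one_kronecker_one, ← hK]
    ext ⟨i, j⟩ ⟨i', j'⟩
    simp [Matrix.sum_apply, Finset.sum_mul]
  | bob K hK Λ hΛ ih =>
    intro ρ
    simp only [Matrix.trace_sum, ih]
    refine sum_trace_conj _ ?_ ρ
    simp only [Matrix.conjTranspose_kronecker, ← Matrix.mul_kronecker_mul,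
      Matrix.conjTranspose_one, Matrix.mul_one]
    rw [← Matrix.one_kronecker_one, ← hK]
    ext ⟨i, j⟩ ⟨i', j'⟩
    simp [Matrix.sum_apply, Finset.mul_sum]

/-- LOCC maps send pure product states to mixtures of pure product states. -/
theorem IsLOCC.exists_sum_prodVec (h : IsLOCC A' B' A B Γ) :
    ∀ (a : A → ℂ) (b : B → ℂ), ∃ (ι : Type) (_ : Fintype ι) (a' : ι → A' → ℂ) (b' : ι → B' → ℂ),
      Γ (proj (prodVec a b)) = ∑ i, proj (prodVec (a' i) (b' i)) := by
  induction h with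
  | done => exact fun a b => ⟨Unit, inferInstance, fun _ => a, fun _ => b, by simp⟩
  | @alice A B A₁ _ _ _ _ _ _ k K hK Λ hΛ ih =>
    intro a b
    choose ι hι a' b' h using fun x => ih x (K x *ᵥ a) b
    refine ⟨Σ x, ι x, inferInstance, fun i => a' i.1 i.2, fun i => b' i.1 i.2, ?_⟩
    simp only [proj_conj, kronecker_one_mulVec_prodVec, h, Fintype.sum_sigma]
  | @bob A B B₁ _ _ _ _ _ _ k K hK Λ hΛ ih =>
    intro a b
    choose ι hι a' b' h using fun x => ih x a (K x *ᵥ b)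
    refine ⟨Σ x, ι x, inferInstance, fun i => a' i.1 i.2, fun i => b' i.1 i.2, ?_⟩
    simp only [proj_conj, one_kronecker_mulVec_prodVec, h, Fintype.sum_sigma]

end LOCC

/-! ### Overlaps with EPR pairs -/

section EPR

theorem eprVec_apply (m : ℕ) (x y : Qubits m) :
    eprVec m (x, y) = if x = y then ((1 / Real.sqrt 2 : ℝ) : ℂ) ^ m else 0 := by
  unfold eprVec
  split_ifs with h
  · subst h; simp
  · obtain ⟨i, hi⟩ := Function.ne_iff.1 h
    exact Finset.prod_eq_zero (Finset.mem_univ i) (by simp [hi])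

theorem sqrt_two_inv_pow_mul_self (m : ℕ) :
    (1 / Real.sqrt 2) ^ m * (1 / Real.sqrt 2) ^ m = ((2 : ℝ) ^ m)⁻¹ := by
  rw [← mul_pow, div_mul_div_comm, Real.mul_self_sqrt (by norm_num)]
  simp

theorem eprVec_dotProduct_star (m : ℕ) : eprVec m ⬝ᵥ star (eprVec m) = 1 := by
  simp only [dotProduct, Fintype.sum_prod_type, Pi.star_apply, eprVec_apply]
  have : ∀ x y : Qubits m, (if x = y then ((1 / Real.sqrt 2 : ℝ) : ℂ) ^ m else 0) *
      star (if x = y then ((1 / Real.sqrt 2 : ℝ) : ℂ) ^ m else 0) =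
      if x = y then (((2 : ℝ) ^ m)⁻¹ : ℂ) else 0 := by
    intro x y
    split_ifs
    · rw [star_pow, Complex.star_def, Complex.conj_ofReal, ← Complex.ofReal_pow,
        ← Complex.ofReal_mul, sqrt_two_inv_pow_mul_self]
      push_cast; rfl
    · simp
  simp only [this]
  simp

theorem re_dotProduct_star_self {X : Type} [Fintype X] (a : X → ℂ) :
    (a ⬝ᵥ star a).re = ∑ x, ‖a x‖ ^ 2 := by
  simp [dotProduct, Complex.re_sum, Complex.mul_conj, Complex.normSq_eq_norm_sq]
  norm_cast

/-- Against a product vector the EPR vector sees only `2 ^ (-m/2) * ∑ a x * b x`, and Cauchy–Schwarz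
bounds this sum by the two norms. -/
theorem normSq_eprVec_prodVec_le (m : ℕ) (a b : Qubits m → ℂ) :
    Complex.normSq (star (eprVec m) ⬝ᵥ prodVec a b) ≤
      ((2 : ℝ) ^ m)⁻¹ * (prodVec a b ⬝ᵥ star (prodVec a b)).re := by
  have h1 : star (eprVec m) ⬝ᵥ prodVec a b =
      (((1 / Real.sqrt 2) ^ m : ℝ) : ℂ) * ∑ x, a x * b x := by
    simp only [dotProduct, Fintype.sum_prod_type, Pi.star_apply, eprVec_apply, prodVec,
      Finset.mul_sum]
    refine Finset.sum_congr rfl fun x _ => ?_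
    rw [Finset.sum_eq_single x (by intro y _ hy; simp [Ne.symm hy]) (by simp)]
    simp
  have h2 : (prodVec a b ⬝ᵥ star (prodVec a b)).re = (∑ x, ‖a x‖ ^ 2) * ∑ x, ‖b x‖ ^ 2 := by
    rw [re_dotProduct_star_self, Fintype.sum_prod_type, Finset.sum_mul_sum]
    simp [prodVec, mul_pow]
  rw [h1, h2, Complex.normSq_mul, Complex.normSq_ofReal, sqrt_two_inv_pow_mul_self]
  refine mul_le_mul_of_nonneg_left ?_ (by positivity)
  rw [Complex.normSq_eq_norm_sq]
  calc ‖∑ x, a x * b x‖ ^ 2 ≤ (∑ x, ‖a x‖ * ‖b x‖) ^ 2 := by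
        gcongr
        exact (norm_sum_le _ _).trans (by simp)
    _ ≤ _ := Finset.sum_mul_sq_le_sq_mul_sq _ _ _

/-- The overlap of the image of a product state under an LOCC map with `m` EPR pairs. -/
theorem IsLOCC.overlap_prodVec_le {A B : Type} [Fintype A] [DecidableEq A] [Fintype B]
    [DecidableEq B] {m : ℕ} {Γ : BiMap A B (Qubits m) (Qubits m)}
    (h : IsLOCC (Qubits m) (Qubits m) A B Γ) (a : A → ℂ) (b : B → ℂ) :
    (overlap (eprVec m) (Γ (proj (prodVec a b)))).re ≤
      ((2 : ℝ) ^ m)⁻¹ * (prodVec a b ⬝ᵥ star (prodVec a b)).re := by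
  obtain ⟨ι, _, a', b', hΓ⟩ := h.exists_sum_prodVec a b
  have ht := h.trace_eq (proj (prodVec a b))
  rw [hΓ, Matrix.trace_sum] at ht
  simp only [trace_proj] at ht
  rw [← ht, hΓ, overlap_sum, Complex.re_sum, Complex.re_sum, Finset.mul_sum]
  refine Finset.sum_le_sum fun i _ => ?_
  rw [overlap_proj, Complex.ofReal_re]
  exact normSq_eprVec_prodVec_le m _ _

theorem overlap_nonneg {X : Type} [Fintype X] (φ : X → ℂ) {M : Matrix X X ℂ}
    (hM : M.PosSemidef) : 0 ≤ (overlap φ M).re := by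
  have := hM.dotProduct_mulVec_nonneg φ
  exact (Complex.le_def.1 this).1

theorem normSq_dotProduct_le {X : Type} [Fintype X] (φ ψ : X → ℂ) :
    Complex.normSq (star φ ⬝ᵥ ψ) ≤ (φ ⬝ᵥ star φ).re * (ψ ⬝ᵥ star ψ).re := by
  rw [Complex.normSq_eq_norm_sq, re_dotProduct_star_self, re_dotProduct_star_self]
  calc ‖star φ ⬝ᵥ ψ‖ ^ 2 ≤ (∑ x, ‖φ x‖ * ‖ψ x‖) ^ 2 := by
        gcongr
        exact (norm_sum_le _ _).trans (by simp)
    _ ≤ _ := Finset.sum_mul_sq_le_sq_mul_sq _ _ _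

/-- A positive semidefinite matrix is a sum of rank-one operators. -/
theorem exists_sum_proj {X : Type} [Fintype X] [DecidableEq X] {M : Matrix X X ℂ}
    (hM : M.PosSemidef) : ∃ v : X → X → ℂ, M = ∑ i, proj (v i) := by
  obtain ⟨C, rfl⟩ := CStarAlgebra.nonneg_iff_eq_star_mul_self.1 hM.nonneg
  refine ⟨fun i x => star (C i x), ?_⟩
  ext x y
  simp [Matrix.mul_apply, Matrix.sum_apply, proj_apply]

/-- By linearity it suffices to treat rank-one operators, where this is Cauchy–Schwarz. -/
theorem overlap_le_trace {X : Type} [Fintype X] [DecidableEq X] (φ : X → ℂ) {M : Matrix X X ℂ}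
    (hM : M.PosSemidef) : (overlap φ M).re ≤ (φ ⬝ᵥ star φ).re * M.trace.re := by
  obtain ⟨v, rfl⟩ := exists_sum_proj hM
  rw [overlap_sum, Matrix.trace_sum, Complex.re_sum, Complex.re_sum, Finset.mul_sum]
  refine Finset.sum_le_sum fun i _ => ?_
  rw [overlap_proj, Complex.ofReal_re, trace_proj]
  exact normSq_dotProduct_le _ _

end EPR

/-! ### Exponential moments of quadratic forms in random signs -/

section Concentration

open MeasureTheory ProbabilityTheory

/-- The vector of signs `(-1) ^ f x`. -/
def signVec {X : Type} (f : X → Bool) : X → ℝ := fun x => if f x then -1 else 1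

theorem signVec_mul_self {X : Type} (f : X → Bool) (x : X) : signVec f x * signVec f x = 1 := by
  unfold signVec; split_ifs <;> norm_num

variable {X : Type} [Fintype X] [DecidableEq X]

/-- The spectral theorem in coordinates. The upper bound on an eigenvalue comes from testing `h1` on
its eigenvector. -/
theorem exists_diagonalization {R : Matrix X X ℝ} (hR : R.PosSemidef)
    (h1 : ∀ w : X → ℝ, w ⬝ᵥ R *ᵥ w ≤ w ⬝ᵥ w) :
    ∃ (μ : X → ℝ) (U : Matrix X X ℝ), (∀ k, 0 ≤ μ k) ∧ (∀ k, μ k ≤ 1) ∧ ∑ k, μ k = R.trace ∧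
      Uᵀ * U = 1 ∧ ∀ v : X → ℝ, v ⬝ᵥ R *ᵥ v = ∑ k, μ k * (v ᵥ* U) k ^ 2 := by
  set U : Matrix X X ℝ := (hR.isHermitian.eigenvectorUnitary : Matrix X X ℝ) with hU
  have hUU : Uᵀ * U = 1 := by
    have := Matrix.mem_unitaryGroup_iff'.1 hR.isHermitian.eigenvectorUnitary.2
    simpa [Matrix.star_eq_conjTranspose] using this
  have hq : ∀ v : X → ℝ, v ⬝ᵥ R *ᵥ v =
      ∑ k, hR.isHermitian.eigenvalues k * (v ᵥ* U) k ^ 2 := by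
    intro v
    have hs : R = U * Matrix.diagonal hR.isHermitian.eigenvalues * Uᵀ := by
      conv_lhs => rw [hR.isHermitian.spectral_theorem]
      simp [Unitary.conjStarAlgAut_apply, Matrix.star_eq_conjTranspose, hU]
    conv_lhs => rw [hs]
    rw [← Matrix.mulVec_mulVec, ← Matrix.mulVec_mulVec, Matrix.dotProduct_mulVec,
      Matrix.mulVec_transpose]
    simp only [dotProduct, Matrix.mulVec_diagonal]
    exact Finset.sum_congr rfl fun _ _ => by ring
  refine ⟨hR.isHermitian.eigenvalues, U, hR.eigenvalues_nonneg, fun k => ?_, ?_, hUU, hq⟩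
  · have h := h1 (U *ᵥ Pi.single k 1)
    have e : (U *ᵥ Pi.single k 1) ᵥ* U = Pi.single k 1 := by
      rw [← Matrix.mulVec_transpose, Matrix.mulVec_mulVec, hUU, Matrix.one_mulVec]
    rw [hq, Matrix.dotProduct_mulVec, e] at h
    simpa [Pi.single_apply] using h
  · rw [hR.isHermitian.trace_eq_sum_eigenvalues]; simp

theorem integral_exp_mul_gaussian (t : ℝ) :
    ∫ x, Real.exp (t * x) ∂gaussianReal 0 1 = Real.exp (t ^ 2 / 2) := by
  have := congrFun (mgf_fun_id_gaussianReal (μ := 0) (v := 1)) t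
  simpa [mgf] using this

theorem integral_exp_sq_gaussian {c : ℝ} (hc : c < 1 / 2) :
    ∫ x, Real.exp (c * x ^ 2) ∂gaussianReal 0 1 = 1 / Real.sqrt (1 - 2 * c) := by
  rw [integral_gaussianReal_eq_integral_smul one_ne_zero]
  have : ∀ x : ℝ, gaussianPDFReal 0 1 x • Real.exp (c * x ^ 2) =
      (Real.sqrt (2 * Real.pi))⁻¹ * Real.exp (-(1 / 2 - c) * x ^ 2) := by
    intro x
    simp only [gaussianPDFReal, smul_eq_mul, NNReal.coe_one, mul_one, sub_zero, mul_assoc,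
      ← Real.exp_add]
    ring_nf
  simp only [this]
  rw [integral_const_mul, integral_gaussian, ← Real.sqrt_inv, ← Real.sqrt_mul (by positivity),
    ← Real.sqrt_one, ← Real.sqrt_div zero_le_one, Real.sqrt_one]
  congr 1
  have : (1 / 2 - c) ≠ 0 := by linarith
  have : (1 - 2 * c) ≠ 0 := by linarith
  field_simp

theorem integrable_exp_sq_gaussian {c : ℝ} (hc : c < 1 / 2) :
    Integrable (fun x => Real.exp (c * x ^ 2)) (gaussianReal 0 1) := by
  -- The integral of a non-integrable function is `0` by convention, so a nonzero value proves
  -- integrability.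
  refine Integrable.of_integral_ne_zero ?_
  rw [integral_exp_sq_gaussian hc]
  have : 0 < 1 - 2 * c := by linarith
  positivity

/-- After squaring, `1 + x ≤ exp x` reduces this to `(1 - μ/4) * (1 + 2μ/5) ≥ 1`, which holds on
`[0, 1]`. -/
theorem one_div_sqrt_le_exp {μ : ℝ} (h0 : 0 ≤ μ) (h1 : μ ≤ 1) :
    1 / Real.sqrt (1 - 2 * (μ / 8)) ≤ Real.exp (μ / 5) := by
  have hp : 0 < 1 - 2 * (μ / 8) := by linarith
  rw [div_le_iff₀ (Real.sqrt_pos.2 hp), ← Real.sqrt_sq (Real.exp_pos (μ / 5)).le,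
    ← Real.sqrt_mul (by positivity)]
  refine Real.le_sqrt_of_sq_le ?_
  rw [← Real.exp_nat_mul]
  have h := Real.add_one_le_exp (((2 : ℕ) : ℝ) * (μ / 5))
  push_cast at h ⊢
  nlinarith

/-- Independence of the signs factorises the sum into `∏ 2 cosh (h x)`, and `cosh t ≤ exp (t² / 2)`.
-/
theorem sum_exp_signVec_le (h : X → ℝ) :
    ∑ f : X → Bool, Real.exp (signVec f ⬝ᵥ h) ≤
      2 ^ Fintype.card X * Real.exp ((∑ x, h x ^ 2) / 2) := by
  have e : ∑ f : X → Bool, Real.exp (signVec f ⬝ᵥ h) = ∏ x, (2 * Real.cosh (h x)) := by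
    have : ∀ x, 2 * Real.cosh (h x) = ∑ b : Bool, Real.exp ((if b then -1 else 1) * h x) := by
      intro x
      rw [Real.cosh_eq]
      simp
      ring
    simp only [this]
    rw [Fintype.prod_sum]
    simp only [← Real.exp_sum]
    rfl
  rw [e, Finset.prod_mul_distrib, Finset.prod_const, Finset.card_univ, Finset.sum_div,
    Real.exp_sum]
  gcongr with x
  exact Real.cosh_le_exp_half_sq _

/-- Exponential moment of a quadratic form in independent random signs. -/
theorem sum_exp_quadForm_le {R : Matrix X X ℝ} (hR : R.PosSemidef)
    (h1 : ∀ w : X → ℝ, w ⬝ᵥ R *ᵥ w ≤ w ⬝ᵥ w) :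
    ∑ f : X → Bool, Real.exp ((signVec f ⬝ᵥ R *ᵥ signVec f) / 8) ≤
      2 ^ Fintype.card X * Real.exp (R.trace / 5) := by
  obtain ⟨μ, U, hμ0, hμ1, htr, hU, hq⟩ := exists_diagonalization hR h1
  -- Gaussian linearisation: `exp (t² / 2)` is the mean of `exp (t * g)` for a standard Gaussian
  -- `g`. The factor `√μ / 2` in `t` makes `t² / 2` equal to `μ * (v ᵥ* U) k ^ 2 / 8`. The exponent
  -- becomes linear in the signs, so they can be summed first, for fixed `g`.
  set γ : Measure (X → ℝ) := Measure.pi fun _ => gaussianReal 0 1 with hγ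
  set t : (X → Bool) → X → ℝ := fun f k => Real.sqrt (μ k) / 2 * (signVec f ᵥ* U) k with ht
  have hint : ∀ f, Integrable (fun g : X → ℝ => ∏ k, Real.exp (t f k * g k)) γ := fun f =>
    Integrable.fintype_prod fun k => integrable_exp_mul_gaussianReal (t f k)
  have hlin : ∀ f : X → Bool, Real.exp ((signVec f ⬝ᵥ R *ᵥ signVec f) / 8) =
      ∫ g : X → ℝ, ∏ k, Real.exp (t f k * g k) ∂γ := by
    intro f
    rw [hγ, integral_fintype_prod_eq_prod (fun k x => Real.exp (t f k * x))]
    simp only [integral_exp_mul_gaussian, hq, ← Real.exp_sum, Finset.sum_div]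
    congr 1
    refine Finset.sum_congr rfl fun k _ => ?_
    rw [ht]
    simp only [mul_pow, div_pow, Real.sq_sqrt (hμ0 k)]
    ring
  have hc : ∀ k, μ k / 8 < 1 / 2 := fun k => by linarith [hμ1 k]
  have hpt : ∀ g : X → ℝ, ∑ f, ∏ k, Real.exp (t f k * g k) ≤
      2 ^ Fintype.card X * ∏ k, Real.exp (μ k / 8 * g k ^ 2) := by
    intro g
    set y : X → ℝ := fun k => Real.sqrt (μ k) / 2 * g k with hy
    have e1 : ∀ f, ∏ k, Real.exp (t f k * g k) = Real.exp (signVec f ⬝ᵥ U *ᵥ y) := by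
      intro f
      rw [← Real.exp_sum, Matrix.dotProduct_mulVec, dotProduct]
      congr 1
      exact Finset.sum_congr rfl fun k _ => by simp only [ht, hy]; ring
    -- Orthogonality of `U` makes the bound left by the sum over signs a product of functions of
    -- single Gaussian coordinates.
    have e2 : ∑ x, (U *ᵥ y) x ^ 2 = ∑ k, μ k / 4 * g k ^ 2 := by
      have : ∑ x, (U *ᵥ y) x ^ 2 = (U *ᵥ y) ⬝ᵥ (U *ᵥ y) := by simp only [dotProduct, sq]
      rw [this, Matrix.dotProduct_mulVec, ← Matrix.mulVec_transpose, Matrix.mulVec_mulVec, hU,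
        Matrix.one_mulVec, dotProduct]
      refine Finset.sum_congr rfl fun k _ => ?_
      rw [hy, ← sq]
      simp only [mul_pow, div_pow, Real.sq_sqrt (hμ0 k)]
      ring
    simp only [e1]
    refine (sum_exp_signVec_le _).trans_eq ?_
    rw [e2, ← Real.exp_sum, Finset.sum_div]
    congr 2
    exact Finset.sum_congr rfl fun k _ => by ring
  calc ∑ f : X → Bool, Real.exp ((signVec f ⬝ᵥ R *ᵥ signVec f) / 8)
      = ∫ g, ∑ f, ∏ k, Real.exp (t f k * g k) ∂γ := by
        rw [integral_finsetSum _ fun f _ => hint f]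
        exact Finset.sum_congr rfl fun f _ => hlin f
    _ ≤ ∫ g : X → ℝ, 2 ^ Fintype.card X * ∏ k, Real.exp (μ k / 8 * g k ^ 2) ∂γ := by
        refine integral_mono (integrable_finsetSum _ fun f _ => hint f) ?_ hpt
        exact (Integrable.fintype_prod fun k => integrable_exp_sq_gaussian (hc k)).const_mul _
    _ = 2 ^ Fintype.card X * ∏ k, (1 / Real.sqrt (1 - 2 * (μ k / 8))) := by
        rw [integral_const_mul, hγ,
          integral_fintype_prod_eq_prod (fun k x => Real.exp (μ k / 8 * x ^ 2))]
        simp only [integral_exp_sq_gaussian (hc _)]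
    _ ≤ 2 ^ Fintype.card X * Real.exp (R.trace / 5) := by
        rw [← htr, Finset.sum_div, Real.exp_sum]
        gcongr with k
        exact one_div_sqrt_le_exp (hμ0 k) (hμ1 k)

/-- Few sign vectors have a large quadratic form with a matrix of small trace. -/
theorem card_quadForm_ge_le {R : Matrix X X ℝ} (hR : R.PosSemidef)
    (h1 : ∀ w : X → ℝ, w ⬝ᵥ R *ᵥ w ≤ w ⬝ᵥ w) (htr : R.trace ≤ (Fintype.card X : ℝ) / 2)
    (S : Finset (X → Bool))
    (hS : ∀ f ∈ S, 9 / 10 * (Fintype.card X : ℝ) ≤ signVec f ⬝ᵥ R *ᵥ signVec f) :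
    (S.card : ℝ) ≤ 2 ^ Fintype.card X * Real.exp (-(Fintype.card X : ℝ) / 80) := by
  set N : ℝ := (Fintype.card X : ℝ) with hN
  -- Markov's inequality for the exponential moment: membership in `S` gives exponent `9N/80`, the
  -- trace bound gives `N/10 = 8N/80`, and `N/80` remains.
  have h : (S.card : ℝ) * Real.exp (9 / 80 * N) ≤ 2 ^ Fintype.card X * Real.exp (N / 10) := by
    calc (S.card : ℝ) * Real.exp (9 / 80 * N) = ∑ f ∈ S, Real.exp (9 / 80 * N) := by simp
      _ ≤ ∑ f ∈ S, Real.exp ((signVec f ⬝ᵥ R *ᵥ signVec f) / 8) :=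
        Finset.sum_le_sum fun f hf => Real.exp_le_exp.2 (by linarith [hS f hf])
      _ ≤ ∑ f : X → Bool, Real.exp ((signVec f ⬝ᵥ R *ᵥ signVec f) / 8) :=
        Finset.sum_le_univ_sum_of_nonneg fun f => (Real.exp_pos _).le
      _ ≤ 2 ^ Fintype.card X * Real.exp (R.trace / 5) := sum_exp_quadForm_le hR h1
      _ ≤ _ := by
        refine mul_le_mul_of_nonneg_left (Real.exp_le_exp.2 ?_) (by positivity)
        linarith
  rw [← le_div_iff₀ (Real.exp_pos _), mul_div_assoc, ← Real.exp_sub] at h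
  refine h.trans_eq ?_
  congr 2
  ring

end Concentration

/-! ### Counting maps with small circuit descriptions -/

section Counting

attribute [instance] GateSet.fintypeGate

variable {G : GateSet}

/-- The largest number of qubits on which a gate acts. -/
def GateSet.maxArity (G : GateSet) : ℕ := Finset.univ.sup G.arity

/-- Operations are gates with a tuple of wires, or single wires. -/
def opEquiv (G : GateSet) (W : Type) : Op G W ≃ (Σ g : G.Gate, Fin (G.arity g) ↪ W) ⊕ W where
  toFun
    | .gate g e => Sum.inl ⟨g, e⟩
    | .meas w => Sum.inr w
  invFun
    | Sum.inl x => .gate x.1 x.2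
    | Sum.inr w => .meas w
  left_inv o := by cases o <;> rfl
  right_inv x := by rcases x with ⟨g, e⟩ | w <;> rfl

instance Op.instFintype (W : Type) [Fintype W] [DecidableEq W] : Fintype (Op G W) :=
  Fintype.ofEquiv _ (opEquiv G W).symm

/-- The `+ 1` in the exponent lets the same power also bound the number of single-wire measurements,
even when all gates have arity `0`. -/
theorem card_op_le (W : Type) [Fintype W] [DecidableEq W] :
    Fintype.card (Op G W) ≤
      (Fintype.card G.Gate + 1) * (Fintype.card W + 1) ^ (G.maxArity + 1) := by
  rw [Fintype.card_congr (opEquiv G W), Fintype.card_sum, Fintype.card_sigma, add_mul, one_mul]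
  gcongr
  · calc ∑ g : G.Gate, Fintype.card (Fin (G.arity g) ↪ W)
        ≤ ∑ _g : G.Gate, (Fintype.card W + 1) ^ (G.maxArity + 1) := by
          refine Finset.sum_le_sum fun g _ => ?_
          rw [Fintype.card_embedding_eq, Fintype.card_fin]
          calc (Fintype.card W).descFactorial (G.arity g) ≤ Fintype.card W ^ G.arity g :=
                Nat.descFactorial_le_pow _ _
            _ ≤ (Fintype.card W + 1) ^ G.arity g := Nat.pow_le_pow_left (Nat.le_succ _) _
            _ ≤ _ := by
              refine Nat.pow_le_pow_right (Nat.succ_pos _) (Nat.le_succ_of_le ?_)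
              exact Finset.le_sup (f := G.arity) (Finset.mem_univ g)
      _ = _ := by simp
  · exact (Nat.le_succ _).trans (Nat.le_self_pow (Nat.succ_ne_zero _) _)

namespace LOCCCircuit

variable {nA nB mA mB : ℕ} (D : LOCCCircuit G nA nB mA mB)

/-- Elementary steps of a protocol: an operation of either party, a measurement of the
communication register, or nothing. -/
abbrev Step : Type :=
  Option (Op G (Fin (nA + D.tA) ⊕ Fin D.c) ⊕ (Op G (Fin (nB + D.tB) ⊕ Fin D.c) ⊕ Unit))

/-- The effect of an elementary step. -/
def step (ρ : WireMat D.Wires) : D.Step → WireMat D.Wires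
  | none => ρ
  | some (.inl o) => Op.apply D.embA ρ o
  | some (.inr (.inl o)) => Op.apply D.embB ρ o
  | some (.inr (.inr _)) => measureWires D.comm ρ

/-- Measuring the register adds `c` to the size. For `c = 0` it must therefore cost no step, which
is possible because it then does nothing; otherwise a single step is enough. -/
theorem exists_steps_measure :
    ∃ L : List D.Step, L.length ≤ D.c ∧ ∀ ρ, L.foldl D.step ρ = measureWires D.comm ρ := by
  rcases Nat.eq_zero_or_pos D.c with h | h
  · refine ⟨[], Nat.zero_le _, fun ρ => ?_⟩
    ext x y
    have : x ∘ D.comm = y ∘ D.comm := funext fun j => absurd j.2 (by omega)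
    simp [measureWires, this]
  · exact ⟨[some (.inr (.inr ()))], h, fun ρ => rfl⟩

theorem exists_steps_round
    (R : Circuit G (Fin (nA + D.tA) ⊕ Fin D.c) × Circuit G (Fin (nB + D.tB) ⊕ Fin D.c)) :
    ∃ L : List D.Step, L.length ≤ R.1.length + D.c + (R.2.length + D.c) ∧
      ∀ ρ, L.foldl D.step ρ = D.round ρ R := by
  obtain ⟨M, hM, hm⟩ := D.exists_steps_measure
  refine ⟨R.1.map (fun o => some (.inl o)) ++ M ++ (R.2.map (fun o => some (.inr (.inl o))) ++ M),
    by simp only [List.length_append, List.length_map]; omega, fun ρ => ?_⟩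
  simp only [List.foldl_append, List.foldl_map, hm]
  rfl

theorem exists_steps_rounds
    (l : List (Circuit G (Fin (nA + D.tA) ⊕ Fin D.c) × Circuit G (Fin (nB + D.tB) ⊕ Fin D.c))) :
    ∃ L : List D.Step,
      L.length ≤ (l.map fun R => R.1.length + D.c + (R.2.length + D.c)).sum ∧
        ∀ ρ, L.foldl D.step ρ = l.foldl D.round ρ := by
  induction l with
  | nil => exact ⟨[], by simp, fun _ => rfl⟩
  | cons R l ih =>
    obtain ⟨L, hL, h⟩ := ih
    obtain ⟨M, hM, hm⟩ := D.exists_steps_round R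
    refine ⟨M ++ L, ?_, fun ρ => ?_⟩
    · simp only [List.length_append, List.map_cons, List.sum_cons]; omega
    · simp [List.foldl_append, hm, h]

/-- Flattening the rounds forgets where they end, and padding with idle steps brings every
description to length exactly `s`. -/
theorem exists_vector_steps {s : ℕ} (hs : D.size ≤ s) :
    ∃ v : List.Vector D.Step s,
      D.run = fun φ => D.output (v.toList.foldl D.step (D.init φ)) := by
  obtain ⟨L, hL, h⟩ := D.exists_steps_rounds D.rounds
  have hL' : L.length ≤ s := by unfold size at hs; omega
  refine ⟨⟨L ++ List.replicate (s - L.length) none, by simp [hL']⟩, ?_⟩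
  funext φ
  have hn : ∀ (k : ℕ) (ρ : WireMat D.Wires), (List.replicate k none).foldl D.step ρ = ρ := by
    intro k
    induction k with
    | zero => exact fun _ => rfl
    | succ k ih => exact fun ρ => by rw [List.replicate_succ, List.foldl_cons]; exact ih _
  simp [List.foldl_append, hn, h, run]

theorem card_step_le {s : ℕ} (hA : D.tA ≤ s) (hB : D.tB ≤ s) (hc : D.c ≤ s) :
    Fintype.card D.Step ≤ 2 * ((Fintype.card G.Gate + 1) *
      (nA + nB + 2 * s + 1) ^ (G.maxArity + 1)) + 2 := by
  have h1 := card_op_le (G := G) (Fin (nA + D.tA) ⊕ Fin D.c)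
  have h2 := card_op_le (G := G) (Fin (nB + D.tB) ⊕ Fin D.c)
  simp only [Fintype.card_sum, Fintype.card_fin] at h1 h2
  have h3 : (Fintype.card G.Gate + 1) * (nA + D.tA + D.c + 1) ^ (G.maxArity + 1) ≤
      (Fintype.card G.Gate + 1) * (nA + nB + 2 * s + 1) ^ (G.maxArity + 1) := by
    exact Nat.mul_le_mul_left _ (Nat.pow_le_pow_left (by omega) _)
  have h4 : (Fintype.card G.Gate + 1) * (nB + D.tB + D.c + 1) ^ (G.maxArity + 1) ≤
      (Fintype.card G.Gate + 1) * (nA + nB + 2 * s + 1) ^ (G.maxArity + 1) := by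
    exact Nat.mul_le_mul_left _ (Nat.pow_le_pow_left (by omega) _)
  simp only [Step, Fintype.card_option, Fintype.card_sum, Fintype.card_unit]
  omega

end LOCCCircuit

/-- A bound on the number of maps with a circuit description of size at most `s` acting on `w`
input qubits. -/
def circuitBound (G : GateSet) (w s : ℕ) : ℕ :=
  (s + 1) ^ 3 * (2 * ((Fintype.card G.Gate + 1) * (w + 2 * s + 1) ^ (G.maxArity + 1)) + 2) ^ s

theorem exists_finset_run_of_params (nA nB mA mB s tA tB c : ℕ) (hA : tA ≤ s) (hB : tB ≤ s)
    (hc : c ≤ s) :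
    ∃ S : Finset (BiMap (Qubits nA) (Qubits nB) (Qubits mA) (Qubits mB)),
      S.card ≤ (2 * ((Fintype.card G.Gate + 1) *
        (nA + nB + 2 * s + 1) ^ (G.maxArity + 1)) + 2) ^ s ∧
      ∀ D : LOCCCircuit G nA nB mA mB, D.tA = tA → D.tB = tB → D.c = c → D.size ≤ s →
        D.run ∈ S := by
  classical
  by_cases h : mA ≤ nA + tA ∧ mB ≤ nB + tB
  -- Steps, initialisation and output depend on the register sizes only, so the description `E`
  -- without rounds serves as a common reference for all descriptions with these sizes.
  · let E : LOCCCircuit G nA nB mA mB := ⟨tA, tB, c, [], h.1, h.2⟩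
    refine ⟨(Finset.univ : Finset (List.Vector E.Step s)).image
      fun v φ => E.output (v.toList.foldl E.step (E.init φ)), ?_, ?_⟩
    · refine Finset.card_image_le.trans ?_
      rw [Finset.card_univ, card_vector]
      exact Nat.pow_le_pow_left (E.card_step_le hA hB hc) s
    · rintro D rfl rfl rfl hs
      obtain ⟨v, hv⟩ := D.exists_vector_steps hs
      have hstep : D.step = E.step := by
        funext ρ t
        rcases t with _ | _ | _ | _ <;> rfl
      rw [hv, hstep]
      exact Finset.mem_image.2 ⟨v, Finset.mem_univ _, rfl⟩
  · refine ⟨∅, Nat.zero_le _, ?_⟩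
    rintro D rfl rfl rfl -
    exact absurd ⟨D.leA, D.leB⟩ h

/-- Few maps have a circuit description of a given size. -/
theorem exists_finset_run (G : GateSet) (nA nB mA mB s : ℕ) :
    ∃ S : Finset (BiMap (Qubits nA) (Qubits nB) (Qubits mA) (Qubits mB)),
      S.card ≤ circuitBound G (nA + nB) s ∧
      ∀ D : LOCCCircuit G nA nB mA mB, D.size ≤ s → D.run ∈ S := by
  classical
  -- Each of the three register sizes is at most `s`, which accounts for the factor `(s + 1) ^ 3`.
  choose S hS hmem using fun t : Fin (s + 1) × Fin (s + 1) × Fin (s + 1) =>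
    exists_finset_run_of_params (G := G) nA nB mA mB s t.1 t.2.1 t.2.2
      (Nat.lt_succ_iff.1 t.1.2) (Nat.lt_succ_iff.1 t.2.1.2) (Nat.lt_succ_iff.1 t.2.2.2)
  refine ⟨Finset.univ.biUnion S, ?_, fun D hD => ?_⟩
  · refine (Finset.card_biUnion_le_card_mul _ _ _ fun t _ => hS t).trans_eq ?_
    simp only [Finset.card_univ, Fintype.card_prod, Fintype.card_fin, circuitBound]
    ring
  · have hs := hD
    unfold LOCCCircuit.size at hs
    refine Finset.mem_biUnion.2 ⟨(⟨D.tA, by omega⟩, ⟨D.tB, by omega⟩, ⟨D.c, by omega⟩),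
      Finset.mem_univ _, hmem _ D rfl rfl rfl hD⟩

theorem circuitBound_mono (G : GateSet) {w w' s : ℕ} (h : w ≤ w') :
    circuitBound G w s ≤ circuitBound G w' s := by
  unfold circuitBound; gcongr

end Counting

/-! ### Growth estimates -/

section Asymptotics

/-- The circuit bound for `s = 2 ^ (n / 4)` is eventually much smaller than `exp (2 ^ n / 80)`. -/
theorem eventually_circuitBound_lt (G : GateSet) :
    ∀ᶠ n : ℕ in atTop, ((n + 2 ^ (n / 4) + 1 : ℕ) : ℝ) *
      (circuitBound G (2 * n + 2 * 2 ^ (n / 4)) (2 ^ (n / 4)) : ℝ) <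
        Real.exp ((2 : ℝ) ^ n / 80) := by
  set a := G.maxArity
  set g := Fintype.card G.Gate
  -- All factors are bounded by powers of `N = 2 ^ n`, with total exponent `9 + (5 * (a + 1) + 4) *
  -- s`; this `C` absorbs it because `s ≥ 1`.
  set C : ℕ := 6 * (a + 1) + 20 with hC
  have hg : ∀ᶠ n : ℕ in atTop, g + 1 ≤ n := eventually_ge_atTop _
  -- As `s ≤ √2 ^ n`, the logarithm of the count is at most `C * n * √2 ^ n`, which this limit puts
  -- below `2 ^ n / 80`.
  have hlim : ∀ᶠ n : ℕ in atTop, (80 * C : ℝ) * ((n : ℝ) ^ 1 / Real.sqrt 2 ^ n) < 1 := by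
    have := (tendsto_pow_const_div_const_pow_of_one_lt 1
      (r := Real.sqrt 2) (by rw [Real.lt_sqrt] <;> norm_num)).const_mul (80 * C : ℝ)
    rw [mul_zero] at this
    exact this.eventually_lt_const one_pos
  filter_upwards [hg, hlim, eventually_ge_atTop 1] with n hn hl hn1
  set s := 2 ^ (n / 4) with hs
  set N := 2 ^ n with hN
  have hnN : n < N := Nat.lt_two_pow_self
  have hsN : s ≤ N := Nat.pow_le_pow_right (by norm_num) (Nat.div_le_self _ _)
  have hs1 : 1 ≤ s := Nat.one_le_two_pow
  have hN2 : 2 ≤ N := by simpa [hN] using Nat.pow_le_pow_right (n := 2) (by norm_num) hn1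
  have p2 : ∀ k, 2 ^ k ≤ N ^ k := fun k => Nat.pow_le_pow_left hN2 k
  have hw : 2 * n + 2 * s + 2 * s + 1 ≤ N ^ 5 := by
    calc 2 * n + 2 * s + 2 * s + 1 ≤ 2 ^ 4 * N := by omega
      _ ≤ N ^ 4 * N := Nat.mul_le_mul_right _ (p2 4)
      _ = _ := by ring
  have hbase : 2 * ((g + 1) * (2 * n + 2 * s + 2 * s + 1) ^ (a + 1)) + 2 ≤
      N ^ (5 * (a + 1) + 4) := by
    calc 2 * ((g + 1) * (2 * n + 2 * s + 2 * s + 1) ^ (a + 1)) + 2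
        ≤ 2 * (N * (N ^ 5) ^ (a + 1)) + 2 * (N * (N ^ 5) ^ (a + 1)) := by
          gcongr
          · omega
          · have : 1 ≤ N * (N ^ 5) ^ (a + 1) := Nat.one_le_iff_ne_zero.2 (by positivity)
            omega
      _ = 2 ^ 2 * (N * (N ^ 5) ^ (a + 1)) := by ring
      _ ≤ N ^ 2 * (N * (N ^ 5) ^ (a + 1)) := Nat.mul_le_mul_right _ (p2 2)
      _ = N ^ (5 * (a + 1) + 3) := by ring
      _ ≤ _ := Nat.pow_le_pow_right (by omega) (by omega)
  have hcount : (n + s + 1) * circuitBound G (2 * n + 2 * s) s ≤ N ^ (C * s) := by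
    calc (n + s + 1) * circuitBound G (2 * n + 2 * s) s
        ≤ N ^ 3 * ((N ^ 2) ^ 3 * (N ^ (5 * (a + 1) + 4)) ^ s) := by
          unfold circuitBound
          gcongr
          · calc n + s + 1 ≤ 2 ^ 2 * N := by omega
              _ ≤ N ^ 2 * N := Nat.mul_le_mul_right _ (p2 2)
              _ = N ^ 3 := by ring
          · calc s + 1 ≤ 2 * N := by omega
              _ ≤ N * N := Nat.mul_le_mul_right _ hN2
              _ = N ^ 2 := by ring
      _ = N ^ (9 + (5 * (a + 1) + 4) * s) := by ring
      _ ≤ N ^ (C * s) := by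
          refine Nat.pow_le_pow_right (by omega) ?_
          rw [hC]
          nlinarith
  have hlog : ((C * s : ℕ) : ℝ) * (n * Real.log 2) < (2 : ℝ) ^ n / 80 := by
    have hr : Real.sqrt 2 ^ n * Real.sqrt 2 ^ n = (2 : ℝ) ^ n := by
      rw [← mul_pow, Real.mul_self_sqrt (by norm_num)]
    have hsr : (s : ℝ) ≤ Real.sqrt 2 ^ n := by
      refine (sq_le_sq₀ (by positivity) (by positivity)).1 ?_
      rw [sq (Real.sqrt 2 ^ n), hr]
      have : s ^ 2 ≤ 2 ^ n := by
        rw [hs, ← pow_mul]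
        exact Nat.pow_le_pow_right (by norm_num) (by omega)
      exact_mod_cast this
    have hq : 0 < Real.sqrt 2 ^ n := by positivity
    rw [pow_one, mul_div_assoc', div_lt_one hq] at hl
    have hl2 : Real.log 2 ≤ 1 := by linarith [Real.log_two_lt_d9]
    have hl0 : 0 ≤ Real.log 2 := Real.log_nonneg (by norm_num)
    push_cast
    calc (C : ℝ) * s * (n * Real.log 2) ≤ (C : ℝ) * Real.sqrt 2 ^ n * (n * 1) := by gcongr
      _ = (80 * C * n) * Real.sqrt 2 ^ n / 80 := by ring
      _ < Real.sqrt 2 ^ n * Real.sqrt 2 ^ n / 80 := by gcongr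
      _ = _ := by rw [hr]
  calc ((n + s + 1 : ℕ) : ℝ) * (circuitBound G (2 * n + 2 * s) s : ℝ)
      ≤ ((N ^ (C * s) : ℕ) : ℝ) := by exact_mod_cast hcount
    _ = Real.exp (((C * s : ℕ) : ℝ) * (n * Real.log 2)) := by
        rw [Real.exp_nat_mul, Real.exp_nat_mul, Real.exp_log (by norm_num), hN]
        push_cast; rfl
    _ < _ := Real.exp_lt_exp.2 hlog

variable {n : ℕ+ → ℕ}

theorem tendsto_of_superlog
    (h : Tendsto (fun k : ℕ+ => (n k : ℝ) / Real.log (k : ℝ)) atTop atTop) :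
    Tendsto n atTop atTop := by
  have hk : Tendsto (fun k : ℕ+ => Real.log (k : ℝ)) atTop atTop :=
    Real.tendsto_log_atTop.comp (tendsto_natCast_atTop_atTop.comp tendsto_PNat_val_atTop_atTop)
  refine tendsto_natCast_atTop_iff (R := ℝ) |>.1 ?_
  refine tendsto_atTop_mono' _ ?_ hk
  filter_upwards [h.eventually_ge_atTop 1, hk.eventually_gt_atTop 0] with k h1 h2
  rwa [le_div_iff₀ h2, one_mul] at h1

theorem eventually_polynomial_le
    (h : Tendsto (fun k : ℕ+ => (n k : ℝ) / Real.log (k : ℝ)) atTop atTop) (p : Polynomial ℕ) :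
    ∀ᶠ k : ℕ+ in atTop, p.eval (k : ℕ) ≤ 2 ^ (n k / 4) := by
  have hv : Tendsto (fun k : ℕ+ => (k : ℕ)) atTop atTop := tendsto_PNat_val_atTop_atTop
  -- Once `k` exceeds the sum `p.eval 1` of the coefficients, one additional power of `k` absorbs
  -- them.
  have hp : ∀ᶠ k : ℕ+ in atTop, p.eval (k : ℕ) ≤ (k : ℕ) ^ (p.natDegree + 1) := by
    filter_upwards [hv.eventually_ge_atTop (p.eval 1), hv.eventually_ge_atTop 1] with k hk hk1
    rw [Polynomial.eval_eq_sum_range]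
    calc ∑ i ∈ Finset.range (p.natDegree + 1), p.coeff i * (k : ℕ) ^ i
        ≤ ∑ i ∈ Finset.range (p.natDegree + 1), p.coeff i * (k : ℕ) ^ p.natDegree := by
          refine Finset.sum_le_sum fun i hi => Nat.mul_le_mul_left _ ?_
          exact Nat.pow_le_pow_right hk1 (Nat.lt_succ_iff.1 (Finset.mem_range.1 hi))
      _ = p.eval 1 * (k : ℕ) ^ p.natDegree := by
          rw [← Finset.sum_mul, Polynomial.eval_eq_sum_range]; simp
      _ ≤ (k : ℕ) * (k : ℕ) ^ p.natDegree := Nat.mul_le_mul_right _ hk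
      _ = _ := by ring
  set d := p.natDegree + 1
  have hk : Tendsto (fun k : ℕ+ => Real.log (k : ℝ)) atTop atTop :=
    Real.tendsto_log_atTop.comp (tendsto_natCast_atTop_atTop.comp hv)
  -- The `3` pays for rounding in `n k / 4`, because `log 2 ≤ 1 ≤ log k`.
  filter_upwards [hp, h.eventually_ge_atTop ((4 * d + 3) / Real.log 2),
    hk.eventually_ge_atTop 1] with k h1 h2 h3
  refine h1.trans ?_
  have hl : 0 < Real.log 2 := Real.log_pos (by norm_num)
  have hl2 : Real.log 2 ≤ 1 := by linarith [Real.log_two_lt_d9]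
  rw [le_div_iff₀ (by linarith), div_mul_eq_mul_div, div_le_iff₀ hl] at h2
  have hdiv : (n k : ℝ) ≤ 4 * ((n k / 4 : ℕ) : ℝ) + 3 := by
    have : n k ≤ 4 * (n k / 4) + 3 := by omega
    exact_mod_cast this
  have key : (d : ℝ) * Real.log (k : ℝ) ≤ ((n k / 4 : ℕ) : ℝ) * Real.log 2 := by
    nlinarith
  have hkpos : (0 : ℝ) < (k : ℝ) := by exact_mod_cast k.pos
  have := Real.exp_le_exp.2 key
  rw [Real.exp_nat_mul, Real.exp_nat_mul, Real.exp_log hkpos, Real.exp_log (by norm_num)] at this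
  exact_mod_cast this

end Asymptotics

/-! ### Linear functionals as quadratic forms in the signs -/

section QuadraticForm

variable {X Y : Type} [Fintype X] [DecidableEq Y]

/-- The vector with coordinates `w x` at the basis labels `e x`. -/
def liftVec (e : X → Y) (w : X → ℝ) : Y → ℂ := fun y => ∑ x, if e x = y then (w x : ℂ) else 0

theorem proj_liftVec (e : X → Y) (w : X → ℝ) :
    proj (liftVec e w) = ∑ x, ∑ y, ((w x * w y : ℝ) : ℂ) • Matrix.single (e x) (e y) 1 := by
  ext i j
  simp only [proj_apply, liftVec, star_sum, Finset.sum_mul_sum, Matrix.sum_apply,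
    Matrix.smul_apply, Matrix.single_apply, smul_eq_mul]
  refine Finset.sum_congr rfl fun x _ => Finset.sum_congr rfl fun y _ => ?_
  by_cases h1 : e x = i <;> by_cases h2 : e y = j <;> simp [h1, h2]

/-- The real symmetric matrix of the quadratic form `w ↦ ℓ |w⟩⟨w|` on the span of the basis
vectors `e x`. -/
def formMatrix (ℓ : Matrix Y Y ℂ →ₗ[ℂ] ℂ) (e : X → Y) : Matrix X X ℝ :=
  Matrix.of fun x y =>
    ((ℓ (Matrix.single (e x) (e y) 1)).re + (ℓ (Matrix.single (e y) (e x) 1)).re) / 2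

theorem trace_formMatrix (ℓ : Matrix Y Y ℂ →ₗ[ℂ] ℂ) (e : X → Y) :
    (formMatrix ℓ e).trace = ∑ x, (ℓ (Matrix.single (e x) (e x) 1)).re := by
  simp [Matrix.trace, formMatrix]

theorem signVec_div_dotProduct [Nonempty X] (f : X → Bool) :
    (fun x => signVec f x / Real.sqrt (Fintype.card X)) ⬝ᵥ
      (fun x => signVec f x / Real.sqrt (Fintype.card X)) = 1 := by
  simp only [dotProduct, div_mul_div_comm, signVec_mul_self,
    Real.mul_self_sqrt (Nat.cast_nonneg _)]
  simp

theorem re_map_proj_liftVec (ℓ : Matrix Y Y ℂ →ₗ[ℂ] ℂ) (e : X → Y) (w : X → ℝ) :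
    (ℓ (proj (liftVec e w))).re = w ⬝ᵥ formMatrix ℓ e *ᵥ w := by
  have h1 : (ℓ (proj (liftVec e w))).re =
      ∑ x, ∑ y, w x * w y * (ℓ (Matrix.single (e x) (e y) 1)).re := by
    simp only [proj_liftVec, map_sum, map_smul, Complex.re_sum, smul_eq_mul, Complex.re_ofReal_mul]
  -- The coefficients `w x * w y` are symmetric, so only the symmetrised matrix contributes.
  have h2 : (ℓ (proj (liftVec e w))).re =
      ∑ x, ∑ y, w x * w y * (ℓ (Matrix.single (e y) (e x) 1)).re := by
    rw [h1, Finset.sum_comm]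
    exact Finset.sum_congr rfl fun _ _ => Finset.sum_congr rfl fun _ _ => by ring
  have h3 : w ⬝ᵥ formMatrix ℓ e *ᵥ w =
      (∑ x, ∑ y, w x * w y * (ℓ (Matrix.single (e x) (e y) 1)).re +
        ∑ x, ∑ y, w x * w y * (ℓ (Matrix.single (e y) (e x) 1)).re) / 2 := by
    simp only [dotProduct, Matrix.mulVec, formMatrix, Matrix.of_apply, Finset.mul_sum,
      ← Finset.sum_add_distrib, Finset.sum_div]
    exact Finset.sum_congr rfl fun _ _ => Finset.sum_congr rfl fun _ _ => by ring
  rw [h3, ← h1, ← h2]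
  ring

theorem formMatrix_posSemidef {ℓ : Matrix Y Y ℂ →ₗ[ℂ] ℂ} (e : X → Y)
    (h0 : ∀ ψ : Y → ℂ, 0 ≤ (ℓ (proj ψ)).re) : (formMatrix ℓ e).PosSemidef := by
  refine Matrix.PosSemidef.of_dotProduct_mulVec_nonneg ?_ fun w => ?_
  · ext x y
    simp [formMatrix, add_comm]
  · rw [star_trivial, ← re_map_proj_liftVec]
    exact h0 _

/-- The uniform superposition of the basis vectors `e x` with signs `(-1) ^ f x`. -/
def signState (e : X → Y) (f : X → Bool) : Y → ℂ :=
  liftVec e fun x => signVec f x / Real.sqrt (Fintype.card X)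

theorem re_map_proj_signState (ℓ : Matrix Y Y ℂ →ₗ[ℂ] ℂ) (e : X → Y) (f : X → Bool) :
    (ℓ (proj (signState e f))).re =
      (signVec f ⬝ᵥ formMatrix ℓ e *ᵥ signVec f) / Fintype.card X := by
  have : (fun x => signVec f x / Real.sqrt (Fintype.card X)) =
      (Real.sqrt (Fintype.card X))⁻¹ • signVec f := by
    ext x; simp [div_eq_inv_mul]
  rw [signState, re_map_proj_liftVec, this, Matrix.mulVec_smul, dotProduct_smul, smul_dotProduct,
    smul_eq_mul, smul_eq_mul, ← mul_assoc, ← mul_inv, Real.mul_self_sqrt (Nat.cast_nonneg _),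
    inv_mul_eq_div]

variable [Fintype Y]

theorem liftVec_dotProduct_star {e : X → Y} (he : Function.Injective e) (w : X → ℝ) :
    liftVec e w ⬝ᵥ star (liftVec e w) = ((w ⬝ᵥ w : ℝ) : ℂ) := by
  rw [← trace_proj, proj_liftVec]
  simp only [Matrix.trace_sum, Matrix.trace_smul, dotProduct]
  push_cast
  refine Finset.sum_congr rfl fun x _ => ?_
  rw [Finset.sum_eq_single x]
  · simp
  · intro y _ hy
    rw [Matrix.trace_single_eq_of_ne _ _ _ (fun h => hy (he h).symm)]
    simp
  · simp

theorem formMatrix_quadForm_le {ℓ : Matrix Y Y ℂ →ₗ[ℂ] ℂ} {e : X → Y}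
    (he : Function.Injective e)
    (h1 : ∀ ψ : Y → ℂ, (ℓ (proj ψ)).re ≤ (ψ ⬝ᵥ star ψ).re) (w : X → ℝ) :
    w ⬝ᵥ formMatrix ℓ e *ᵥ w ≤ w ⬝ᵥ w := by
  rw [← re_map_proj_liftVec]
  refine (h1 _).trans_eq ?_
  rw [liftVec_dotProduct_star he, Complex.ofReal_re]

theorem signState_dotProduct_star [Nonempty X] {e : X → Y} (he : Function.Injective e)
    (f : X → Bool) : signState e f ⬝ᵥ star (signState e f) = 1 := by
  rw [signState, liftVec_dotProduct_star he, signVec_div_dotProduct, Complex.ofReal_one]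

variable [DecidableEq X]

/-- In eigencoordinates each squared coordinate is at most the squared norm, and the eigenvalues are
nonnegative with sum `R.trace`. -/
theorem quadForm_le_trace {R : Matrix X X ℝ} (hR : R.PosSemidef)
    (h1 : ∀ w : X → ℝ, w ⬝ᵥ R *ᵥ w ≤ w ⬝ᵥ w) (v : X → ℝ) :
    v ⬝ᵥ R *ᵥ v ≤ R.trace * (v ⬝ᵥ v) := by
  obtain ⟨μ, U, hμ0, -, htr, hU, hq⟩ := exists_diagonalization hR h1
  have hs : ∑ k, (v ᵥ* U) k ^ 2 = v ⬝ᵥ v := by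
    have : ∑ k, (v ᵥ* U) k ^ 2 = (v ᵥ* U) ⬝ᵥ (v ᵥ* U) := by simp only [dotProduct, sq]
    rw [this, ← Matrix.dotProduct_mulVec, ← Matrix.mulVec_transpose, Matrix.mulVec_mulVec,
      mul_eq_one_comm.1 hU, Matrix.one_mulVec]
  rw [hq, ← htr, Finset.sum_mul]
  refine Finset.sum_le_sum fun k _ => mul_le_mul_of_nonneg_left ?_ (hμ0 k)
  rw [← hs]
  exact Finset.single_le_sum (f := fun k => (v ᵥ* U) k ^ 2) (fun _ _ => sq_nonneg _)
    (Finset.mem_univ k)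

/-- A positive functional of small trace on the span of the `e x` is large on few of the states
`signState e f`. -/
theorem card_signState_ge_le [Nonempty X] {ℓ : Matrix Y Y ℂ →ₗ[ℂ] ℂ} {e : X → Y}
    (he : Function.Injective e) (h0 : ∀ ψ : Y → ℂ, 0 ≤ (ℓ (proj ψ)).re)
    (h1 : ∀ ψ : Y → ℂ, (ℓ (proj ψ)).re ≤ (ψ ⬝ᵥ star ψ).re)
    (htr : ∑ x, (ℓ (Matrix.single (e x) (e x) 1)).re ≤ (Fintype.card X : ℝ) / 2)
    (S : Finset (X → Bool)) (hS : ∀ f ∈ S, 9 / 10 ≤ (ℓ (proj (signState e f))).re) :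
    (S.card : ℝ) ≤ 2 ^ Fintype.card X * Real.exp (-(Fintype.card X : ℝ) / 80) := by
  refine card_quadForm_ge_le (formMatrix_posSemidef e h0) (formMatrix_quadForm_le he h1)
    (by rwa [trace_formMatrix]) S fun f hf => ?_
  have h := hS f hf
  rwa [re_map_proj_signState, le_div_iff₀ (by exact_mod_cast Fintype.card_pos)] at h

end QuadraticForm

/-! ### Fidelity with pure states and entropy of the maximally mixed state -/

section States

variable {X A B : Type} [Fintype X] [DecidableEq X] [Fintype A] [DecidableEq A]
  [Fintype B] [DecidableEq B]

theorem proj_mul_mul_proj {X : Type} [Fintype X] (ψ : X → ℂ) (ρ : Matrix X X ℂ) :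
    proj ψ * ρ * proj ψ = overlap ψ ρ • proj ψ := by
  rw [overlap, proj, Matrix.vecMulVec_mul, Matrix.vecMulVec_mul_vecMulVec,
    Matrix.dotProduct_mulVec]
  ext i j
  simp [Matrix.vecMulVec_apply]
  ring

/-- The pure state of a unit vector. -/
def pureState (ψ : X → ℂ) (h : ψ ⬝ᵥ star ψ = 1) : QState X where
  mat := proj ψ
  posSemidef := proj_posSemidef ψ
  trace_one := by rw [trace_proj, h]

theorem proj_mul_self {ψ : X → ℂ} (h : ψ ⬝ᵥ star ψ = 1) : proj ψ * proj ψ = proj ψ := by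
  have := proj_mul_mul_proj ψ 1
  rwa [Matrix.mul_one, overlap, Matrix.one_mulVec, dotProduct_comm, h, one_smul] at this

/-- The fidelity with a pure state is the overlap with it. -/
theorem fidelity_proj {ρ : Matrix X X ℂ} (hρ : ρ.PosSemidef) {ψ : X → ℂ}
    (h : ψ ⬝ᵥ star ψ = 1) : fidelity ρ (proj ψ) = (overlap ψ ρ).re := by
  have hp : (0 : Matrix X X ℂ) ≤ proj ψ := (proj_posSemidef ψ).nonneg
  have h1 : CFC.sqrt (proj ψ) = proj ψ := CFC.sqrt_unique (proj_mul_self h) hp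
  set r := (overlap ψ ρ).re with hr
  have hr0 : 0 ≤ r := overlap_nonneg ψ hρ
  have hov : overlap ψ ρ = (r : ℂ) := by
    have := Complex.le_def.1 (hρ.dotProduct_mulVec_nonneg ψ)
    exact Complex.ext rfl this.2.symm
  have h2 : CFC.sqrt ((r : ℂ) • proj ψ) = ((Real.sqrt r : ℝ) : ℂ) • proj ψ := by
    refine CFC.sqrt_unique ?_ ?_
    · rw [Matrix.smul_mul, Matrix.mul_smul, smul_smul, proj_mul_self h, ← Complex.ofReal_mul,
        Real.mul_self_sqrt hr0]
    · refine ((proj_posSemidef ψ).smul ?_).nonneg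
      exact_mod_cast Real.sqrt_nonneg r
  rw [fidelity, h1, proj_mul_mul_proj, hov, h2, Matrix.trace_smul, trace_proj, h, smul_eq_mul,
    mul_one, Complex.ofReal_re, Real.sq_sqrt hr0]

theorem entropy_eq_of_mat_eq [Nonempty X] {ρ : QState X}
    (h : ρ.mat = ((Fintype.card X : ℂ)⁻¹) • 1) :
    ρ.entropy = Real.log (Fintype.card X) / Real.log 2 := by
  have he : ∀ i, ρ.posSemidef.isHermitian.eigenvalues i = (Fintype.card X : ℝ)⁻¹ := by
    intro i
    have hv := ρ.posSemidef.isHermitian.mulVec_eigenvectorBasis i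
    set b := ρ.posSemidef.isHermitian.eigenvectorBasis i with hb
    have hb0 : b.ofLp ≠ 0 := by
      intro h0
      have : ‖b‖ = 1 := ρ.posSemidef.isHermitian.eigenvectorBasis.orthonormal.1 i
      have hz : b = 0 := by ext j; exact congrFun h0 j
      rw [hz, norm_zero] at this
      exact zero_ne_one this
    obtain ⟨j, hj⟩ := Function.ne_iff.1 hb0
    -- The eigenvector equation, read at a nonzero coordinate `j`, determines the eigenvalue.
    have hc := congrFun ((congrArg (· *ᵥ b.ofLp) h).symm.trans hv) j
    simp only [Matrix.smul_mulVec, Matrix.one_mulVec, Pi.smul_apply, smul_eq_mul, Complex.real_smul] at hc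
    have := mul_right_cancel₀ hj hc
    refine Complex.ofReal_injective ?_
    push_cast
    exact this.symm
  have hN : (Fintype.card X : ℝ) ≠ 0 := by exact_mod_cast Fintype.card_ne_zero
  simp only [QState.entropy, he, Finset.sum_const, Finset.card_univ, nsmul_eq_mul,
    Real.negMulLog, Real.log_inv]
  field_simp

end States

/-! ### Phase states, local states and their one-shot measures -/

section Families

variable {n : ℕ}

theorem diag_injective {X : Type} : Function.Injective fun x : X => (x, x) :=
  fun _ _ h => (Prod.mk.inj h).1

/-- A maximally entangled state of `n + n` qubits with phases `(-1) ^ f x`. -/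
def phaseState (n : ℕ) (f : Qubits n → Bool) : QState (Qubits n × Qubits n) :=
  pureState (signState (fun x => (x, x)) f) (signState_dotProduct_star diag_injective f)

theorem card_qubits (n : ℕ) : Fintype.card (Qubits n) = 2 ^ n := by simp

theorem signState_diag_apply (f : Qubits n → Bool) (x y : Qubits n) :
    signState (fun x => (x, x)) f (x, y) =
      if x = y then ((signVec f x / Real.sqrt (Fintype.card (Qubits n)) : ℝ) : ℂ) else 0 := by
  simp only [signState, liftVec, Prod.mk.injEq]
  split_ifs with h
  · subst h
    simp
  · refine Finset.sum_eq_zero fun z _ => if_neg ?_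
    rintro ⟨rfl, rfl⟩
    exact h rfl

theorem signState_diag_mul_star (f : Qubits n → Bool) (x y x' y' : Qubits n) :
    (phaseState n f).mat (x, y) (x', y') =
      if x = y ∧ x' = y' then
        ((signVec f x * signVec f x' / Fintype.card (Qubits n) : ℝ) : ℂ) else 0 := by
  change signState (fun x => (x, x)) f (x, y) * star (signState (fun x => (x, x)) f (x', y')) = _
  rw [signState_diag_apply, signState_diag_apply]
  by_cases h1 : x = y <;> by_cases h2 : x' = y' <;> simp only [h1, h2, if_true, if_false,
    and_self, and_true, true_and, star_zero, mul_zero, zero_mul]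
  rw [Complex.star_def, Complex.conj_ofReal, ← Complex.ofReal_mul, div_mul_div_comm,
    Real.mul_self_sqrt (Nat.cast_nonneg _)]

/-- The signs square to one on the diagonal and the partial trace removes everything else, so both
marginals are maximally mixed. -/
theorem entanglementEntropy_phaseState (f : Qubits n → Bool) :
    entanglementEntropy (phaseState n f) = n := by
  have hlog : Real.log (Fintype.card (Qubits n)) / Real.log 2 = n := by
    rw [card_qubits]
    push_cast
    rw [Real.log_pow, mul_div_assoc, div_self (Real.log_pos (by norm_num)).ne', mul_one]
  have hA : (phaseState n f).reduceA.mat = ((Fintype.card (Qubits n) : ℂ)⁻¹) • 1 := by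
    ext x y
    simp only [QState.reduceA, Matrix.sum_apply, Matrix.submatrix_apply, signState_diag_mul_star,
      Matrix.smul_apply, Matrix.one_apply, smul_eq_mul]
    by_cases h : x = y
    · subst h
      simp [signVec_mul_self]
    · rw [Finset.sum_eq_zero]
      · simp [h]
      · rintro z -
        exact if_neg fun hz => h (hz.1.trans hz.2.symm)
  have hB : (phaseState n f).reduceB.mat = ((Fintype.card (Qubits n) : ℂ)⁻¹) • 1 := by
    ext x y
    simp only [QState.reduceB, Matrix.sum_apply, Matrix.submatrix_apply, signState_diag_mul_star,
      Matrix.smul_apply, Matrix.one_apply, smul_eq_mul]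
    by_cases h : x = y
    · subst h
      simp [signVec_mul_self]
    · rw [Finset.sum_eq_zero]
      · simp [h]
      · rintro z -
        exact if_neg fun hz => h (hz.1.symm.trans hz.2)
  rw [entanglementEntropy, entropy_eq_of_mat_eq hA, entropy_eq_of_mat_eq hB, max_self, hlog]

/-- The fidelity of `Γ ρ` with `m` EPR pairs, as a linear functional of `ρ`. -/
def distForm {A B : Type} [Fintype A] [DecidableEq A] [Fintype B] [DecidableEq B] {m : ℕ}
    {Γ : BiMap A B (Qubits m) (Qubits m)} (h : IsLOCC (Qubits m) (Qubits m) A B Γ) :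
    Matrix (A × B) (A × B) ℂ →ₗ[ℂ] ℂ where
  toFun M := overlap (eprVec m) (Γ M)
  map_add' M N := by
    simp only [h.isLinearMap.map_add, overlap, Matrix.add_mulVec, dotProduct_add]
  map_smul' c M := by
    simp only [h.isLinearMap.map_smul, overlap_smul, RingHom.id_apply, smul_eq_mul]

section DistForm

variable {A B : Type} [Fintype A] [DecidableEq A] [Fintype B] [DecidableEq B] {m : ℕ}
  {Γ : BiMap A B (Qubits m) (Qubits m)} (h : IsLOCC (Qubits m) (Qubits m) A B Γ)

theorem distForm_nonneg (ψ : A × B → ℂ) : 0 ≤ (distForm h (proj ψ)).re :=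
  overlap_nonneg _ (h.posSemidef _ (proj_posSemidef ψ))

theorem distForm_le (ψ : A × B → ℂ) : (distForm h (proj ψ)).re ≤ (ψ ⬝ᵥ star ψ).re := by
  have := overlap_le_trace (eprVec m) (h.posSemidef _ (proj_posSemidef ψ))
  rwa [eprVec_dotProduct_star, Complex.one_re, one_mul, h.trace_eq, trace_proj] at this

/-- A basis state is a product state, hence overlaps little with EPR pairs after any LOCC map. This
keeps the trace of the form small. -/
theorem distForm_single_le (a : A) (b : B) :
    (distForm h (Matrix.single (a, b) (a, b) 1)).re ≤ ((2 : ℝ) ^ m)⁻¹ := by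
  have e : Matrix.single (a, b) (a, b) (1 : ℂ) =
      proj (prodVec (Pi.single a 1) (Pi.single b 1)) := by
    ext ⟨i, j⟩ ⟨k, l⟩
    simp only [Matrix.single_apply, proj_apply, prodVec, Pi.single_apply, Prod.mk.injEq,
      @eq_comm _ a, @eq_comm _ b]
    by_cases h1 : i = a <;> by_cases h2 : j = b <;> by_cases h3 : k = a <;>
      by_cases h4 : l = b <;> simp [h1, h2, h3, h4]
  rw [e]
  refine (h.overlap_prodVec_le _ _).trans_eq ?_
  rw [prodVec_dotProduct_star]
  simp

end DistForm

theorem sum_distForm_le {m : ℕ} {Γ : BiMap (Qubits n) (Qubits n) (Qubits m) (Qubits m)}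
    (h : IsLOCC (Qubits m) (Qubits m) (Qubits n) (Qubits n) Γ) :
    ∑ x : Qubits n, (distForm h (Matrix.single (x, x) (x, x) 1)).re ≤
      (Fintype.card (Qubits n) : ℝ) * ((2 : ℝ) ^ m)⁻¹ :=
  (Finset.sum_le_sum fun x _ => distForm_single_le h x x).trans_eq (by simp)

/-- The fidelity is at most the trace of the form, that is `2 ^ n / 2 ^ m`; for `m > n` this is at
most `1 / 2`, below the required `9 / 10`. -/
theorem le_of_distErr_le {m : ℕ} {Γ : BiMap (Qubits n) (Qubits n) (Qubits m) (Qubits m)}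
    (h : IsLOCC (Qubits m) (Qubits m) (Qubits n) (Qubits n) Γ) (f : Qubits n → Bool)
    (he : distErr Γ (phaseState n f) ≤ 1 / 10) : m ≤ n := by
  have h1 : 9 / 10 ≤ (distForm h (proj (signState (fun x => (x, x)) f))).re := by
    change 1 - (distForm h (proj (signState (fun x => (x, x)) f))).re ≤ _ at he
    linarith
  have h2 := quadForm_le_trace (formMatrix_posSemidef (fun x => (x, x)) (distForm_nonneg h))
    (formMatrix_quadForm_le diag_injective (distForm_le h))
    (fun x => signVec f x / Real.sqrt (Fintype.card (Qubits n)))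
  rw [← re_map_proj_liftVec, signVec_div_dotProduct, mul_one, trace_formMatrix] at h2
  have h3 := h1.trans (h2.trans (sum_distForm_le h))
  by_contra! hlt
  rw [card_qubits, ← div_eq_mul_inv, le_div_iff₀ (by positivity)] at h3
  have h4 : (2 : ℝ) ^ (n + 1) ≤ 2 ^ m := pow_le_pow_right₀ (by norm_num) hlt
  have h5 : (0 : ℝ) < 2 ^ n := by positivity
  push_cast at h3
  rw [pow_succ] at h4
  linarith

/-- The signs depend on the label shared by both parties, so one party can undo them with a diagonal
unitary. No efficiency is asked of it here. -/
theorem exists_isLOCC_distErr_phaseState (f : Qubits n → Bool) :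
    ∃ Γ : BiMap (Qubits n) (Qubits n) (Qubits n) (Qubits n),
      IsLOCC (Qubits n) (Qubits n) (Qubits n) (Qubits n) Γ ∧ distErr Γ (phaseState n f) = 0 := by
  set V : Matrix (Qubits n) (Qubits n) ℂ := Matrix.diagonal fun x => (signVec f x : ℂ) with hV
  have hs : ∀ x, (signVec f x : ℂ) * signVec f x = 1 := fun x => by
    exact_mod_cast signVec_mul_self f x
  refine ⟨_, IsLOCC.bob (fun _ : Fin 1 => V) ?_ (fun _ => id) fun _ => IsLOCC.done, ?_⟩
  · simp [hV, Matrix.diagonal_conjTranspose, Matrix.diagonal_mul_diagonal, hs]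
  · have hvec : ((1 : Matrix (Qubits n) (Qubits n) ℂ) ⊗ₖ V) *ᵥ signState (fun x => (x, x)) f =
        eprVec n := by
      rw [hV, ← Matrix.diagonal_one, Matrix.diagonal_kronecker_diagonal]
      ext ⟨x, y⟩
      rw [Matrix.mulVec_diagonal, signState_diag_apply, eprVec_apply]
      split_ifs with hxy
      · subst hxy
        rw [one_mul, Complex.ofReal_div, mul_div_assoc', hs, card_qubits]
        rw [← Complex.ofReal_pow, ← Complex.ofReal_one, ← Complex.ofReal_div]
        congr 1
        rw [div_pow, one_pow]
        congr 1
        push_cast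
        rw [Real.sqrt_eq_iff_mul_self_eq (by positivity) (by positivity), ← mul_pow,
          Real.mul_self_sqrt (by norm_num)]
      · simp
    simp only [distErr, Finset.univ_unique, Finset.sum_singleton, id]
    change 1 - (overlap (eprVec n) (_ * proj (signState (fun x => (x, x)) f) * _)).re = 0
    rw [proj_conj, hvec, overlap_proj, dotProduct_comm, eprVec_dotProduct_star]
    simp

theorem oneShotED_phaseState (f : Qubits n → Bool) {ε : ℝ} (h0 : 0 < ε) (h1 : ε ≤ 1 / 10) :
    oneShotED ε (phaseState n f) = n := by
  refine le_antisymm (sSup_le ?_) (le_sSup ?_)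
  · rintro _ ⟨m, Γ, rfl, hΓ, he⟩
    exact_mod_cast le_of_distErr_le hΓ f (he.trans h1)
  · obtain ⟨Γ, hΓ, he⟩ := exists_isLOCC_distErr_phaseState f
    exact ⟨n, Γ, rfl, hΓ, he.trans_le h0.le⟩

/-- Attaching a fixed basis label of the second party. -/
def attach (n : ℕ) (x : Qubits n) : Qubits n × Qubits n := (x, fun _ => false)

theorem attach_injective : Function.Injective (attach n) := fun _ _ h => (Prod.mk.inj h).1

theorem id_injective : Function.Injective fun x : Qubits n => x := fun _ _ h => h

/-- The product of a sign state of the first party and a basis state of the second. -/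
def localState (n : ℕ) (f : Qubits n → Bool) : QState (Qubits n × Qubits n) :=
  pureState (signState (attach n) f) (signState_dotProduct_star attach_injective f)

theorem signState_attach (f : Qubits n → Bool) :
    signState (attach n) f =
      prodVec (signState (fun x => x) f) (Pi.single (fun _ => false) 1) := by
  ext ⟨x, y⟩
  simp only [signState, liftVec, prodVec, Pi.single_apply, attach, Prod.mk.injEq]
  by_cases h : y = fun _ => false
  · simp [h]
  · simp [h, Ne.symm h]

theorem single_dotProduct_star {X : Type} [Fintype X] [DecidableEq X] (x : X) :
    (Pi.single x 1 : X → ℂ) ⬝ᵥ star (Pi.single x 1) = 1 := by simp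

theorem localState_isProduct (f : Qubits n → Bool) : (localState n f).IsProduct :=
  ⟨pureState _ (signState_dotProduct_star id_injective f), pureState _ (single_dotProduct_star _),
    by
      change proj (signState (attach n) f) = _
      rw [signState_attach, proj_prodVec]
      rfl⟩

/-- Every pure product state can be prepared by local operations. -/
theorem exists_isLOCC_prepare {A B : Type} [Fintype A] [DecidableEq A] [Fintype B]
    [DecidableEq B] {a : A → ℂ} {b : B → ℂ} (ha : a ⬝ᵥ star a = 1) (hb : b ⬝ᵥ star b = 1) :
    ∃ Γ : BiMap (Qubits 0) (Qubits 0) A B, IsLOCC A B (Qubits 0) (Qubits 0) Γ ∧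
      Γ (epr 0) = proj (prodVec a b) := by
  refine ⟨_, IsLOCC.alice (fun _ : Fin 1 => Matrix.of fun x _ => a x) ?_ (fun _ => _) fun _ =>
    IsLOCC.bob (fun _ : Fin 1 => Matrix.of fun x _ => b x) ?_ (fun _ => id)
      fun _ => IsLOCC.done, ?_⟩
  · ext x y
    rw [Subsingleton.elim x y, Finset.univ_unique, Finset.sum_singleton, Matrix.one_apply_eq, ← ha,
      dotProduct_comm]
    rfl
  · ext x y
    rw [Subsingleton.elim x y, Finset.univ_unique, Finset.sum_singleton, Matrix.one_apply_eq, ← hb,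
      dotProduct_comm]
    rfl
  · have h0 : eprVec 0 = prodVec (fun _ => 1) (fun _ => 1) := by
      ext x; simp [eprVec, prodVec]
    simp only [Finset.univ_unique, Finset.sum_singleton, id, epr, h0, proj_conj,
      kronecker_one_mulVec_prodVec, one_kronecker_mulVec_prodVec]
    congr 2 <;> · ext x; simp [Matrix.mulVec, dotProduct]

/-- Local preparation from zero EPR pairs is exact, so the infimum is attained at `0`. -/
theorem oneShotEC_localState (f : Qubits n → Bool) {δ : ℝ} (hδ : 0 ≤ δ) :
    oneShotEC δ (localState n f) = 0 := by
  refine le_antisymm (sInf_le ?_) zero_le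
  obtain ⟨Γ, hΓ, he⟩ := exists_isLOCC_prepare
    (signState_dotProduct_star id_injective f) (single_dotProduct_star fun _ : Fin n => false)
  refine ⟨0, Γ, rfl, hΓ, ?_⟩
  have hu := signState_dotProduct_star attach_injective f
  have hm : (localState n f).mat = proj (signState (attach n) f) := rfl
  rw [dilErr, he, ← signState_attach, hm, fidelity_proj (proj_posSemidef _) hu, overlap_proj,
    dotProduct_comm, hu]
  simpa using hδ

end Families

/-! ### Existence of hard sign patterns by the union bound -/

section HardStates

/-- The maximally entangled state with phases `f` cannot be distilled by small circuits. -/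
def IsHardToDistill (G : GateSet) (n : ℕ) (f : Qubits n → Bool) : Prop :=
  ∀ (m : ℕ) (Γ : BiMap (Qubits n) (Qubits n) (Qubits m) (Qubits m)), 1 ≤ m →
    HasCircuit G Γ (2 ^ (n / 4)) → 1 / 10 < distErr Γ (phaseState n f)

/-- The product state with phases `f` cannot be prepared by small circuits. -/
def IsHardToDilute (G : GateSet) (n : ℕ) (f : Qubits n → Bool) : Prop :=
  ∀ (N : ℕ) (Γ : BiMap (Qubits N) (Qubits N) (Qubits n) (Qubits n)), N ≤ 2 ^ (n / 4) →
    HasCircuit G Γ (2 ^ (n / 4)) → 1 / 10 < dilErr Γ (localState n f)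

/-- Union bound: few sets, each of them small, do not cover all sign patterns. -/
theorem exists_not_mem_of_card_lt {X κ : Type} [Fintype X] [DecidableEq X] {ι : κ → Type}
    {c M K : ℝ} (T : Finset κ) (S : ∀ t, Finset (ι t)) (B : ∀ t, ι t → Finset (X → Bool))
    (hc : 0 ≤ c) (hK : 0 ≤ K) (hT : (T.card : ℝ) ≤ M) (hS : ∀ t ∈ T, ((S t).card : ℝ) ≤ K)
    (hB : ∀ t i, ((B t i).card : ℝ) ≤ 2 ^ Fintype.card X * c) (h : M * K * c < 1) :
    ∃ f : X → Bool, ∀ t ∈ T, ∀ i ∈ S t, f ∉ B t i := by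
  classical
  by_contra! hcon
  have hsub : (Finset.univ : Finset (X → Bool)) ⊆ T.biUnion fun t => (S t).biUnion (B t) := by
    intro f _
    obtain ⟨t, ht, i, hi, hf⟩ := hcon f
    exact Finset.mem_biUnion.2 ⟨t, ht, Finset.mem_biUnion.2 ⟨i, hi, hf⟩⟩
  have h1 : ((2 ^ Fintype.card X : ℕ) : ℝ) ≤ ∑ t ∈ T, ∑ i ∈ S t, ((B t i).card : ℝ) := by
    have := (Finset.card_le_card hsub).trans (Finset.card_biUnion_le.trans
      (Finset.sum_le_sum fun t _ => Finset.card_biUnion_le))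
    rw [Finset.card_univ, Fintype.card_fun, Fintype.card_bool] at this
    exact_mod_cast this
  have h2 : ∑ t ∈ T, ∑ i ∈ S t, ((B t i).card : ℝ) ≤ M * (K * (2 ^ Fintype.card X * c)) := by
    have hp : (0 : ℝ) ≤ 2 ^ Fintype.card X * c := by positivity
    calc ∑ t ∈ T, ∑ i ∈ S t, ((B t i).card : ℝ)
        ≤ ∑ t ∈ T, K * (2 ^ Fintype.card X * c) := by
          refine Finset.sum_le_sum fun t ht => ?_
          refine (Finset.sum_le_card_nsmul _ _ _ fun i _ => hB t i).trans ?_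
          rw [nsmul_eq_mul]
          exact mul_le_mul_of_nonneg_right (hS t ht) hp
      _ = T.card * (K * (2 ^ Fintype.card X * c)) := by rw [Finset.sum_const, nsmul_eq_mul]
      _ ≤ _ := mul_le_mul_of_nonneg_right hT (by positivity)
  have h3 : (0 : ℝ) < 2 ^ Fintype.card X := by positivity
  push_cast at h1
  nlinarith

theorem eventually_exists_hardToDistill (G : GateSet) :
    ∀ᶠ n : ℕ in atTop, ∃ f, IsHardToDistill G n f := by
  classical
  filter_upwards [eventually_circuitBound_lt G] with n hn
  set s := 2 ^ (n / 4) with hs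
  choose S hS hmem using fun m => exists_finset_run G n n m m s
  -- The members of `S m` are not known to be LOCC maps, so that condition is part of the bad event;
  -- where it fails, the bad set is empty.
  let B : ∀ m, BiMap (Qubits n) (Qubits n) (Qubits m) (Qubits m) → Finset (Qubits n → Bool) :=
    fun m Γ => Finset.univ.filter fun f => 1 ≤ m ∧
      IsLOCC (Qubits m) (Qubits m) (Qubits n) (Qubits n) Γ ∧ distErr Γ (phaseState n f) ≤ 1 / 10
  have hB : ∀ m Γ, ((B m Γ).card : ℝ) ≤
      2 ^ Fintype.card (Qubits n) * Real.exp (-(Fintype.card (Qubits n) : ℝ) / 80) := by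
    intro m Γ
    by_cases hg : 1 ≤ m ∧ IsLOCC (Qubits m) (Qubits m) (Qubits n) (Qubits n) Γ
    · refine card_signState_ge_le diag_injective (distForm_nonneg hg.2) (distForm_le hg.2) ?_ _ ?_
      · refine (sum_distForm_le hg.2).trans ?_
        rw [div_eq_mul_inv]
        -- The case `m = 0`, where distillation is trivial, is excluded here: `m ≥ 1` brings the
        -- trace down to half the dimension.
        have : (2 : ℝ) ≤ 2 ^ m := le_self_pow₀ (by norm_num) (by omega)
        gcongr
      · intro f hf
        have he : 1 - (distForm hg.2 (proj (signState (fun x => (x, x)) f))).re ≤ 1 / 10 :=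
          (Finset.mem_filter.1 hf).2.2.2
        linarith
    · have : B m Γ = ∅ := Finset.filter_eq_empty_iff.2 fun f _ h => hg ⟨h.1, h.2.1⟩
      rw [this, Finset.card_empty, Nat.cast_zero]
      positivity
  have hlt : ((n + s + 1 : ℕ) : ℝ) * circuitBound G (2 * n + 2 * s) s *
      Real.exp (-(Fintype.card (Qubits n) : ℝ) / 80) < 1 := by
    rw [card_qubits]
    push_cast at hn ⊢
    rw [neg_div, Real.exp_neg, ← div_eq_mul_inv, div_lt_one (Real.exp_pos _)]
    exact hn
  obtain ⟨f, hf⟩ := exists_not_mem_of_card_lt (X := Qubits n)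
    (c := Real.exp (-(Fintype.card (Qubits n) : ℝ) / 80)) (M := ((n + s + 1 : ℕ) : ℝ))
    (K := circuitBound G (2 * n + 2 * s) s) (Finset.range (n + s + 1)) S B
    (Real.exp_pos _).le (Nat.cast_nonneg _) (by simp)
    (fun m _ => by exact_mod_cast (hS m).trans (circuitBound_mono G (by omega))) hB hlt
  refine ⟨f, fun m Γ hm hΓ => ?_⟩
  obtain ⟨hL, D, hD, hrun⟩ := hΓ
  by_contra! hcon
  have hDs := hD
  have hle := D.leA
  unfold LOCCCircuit.size at hDs
  -- The output qubits lie in a private register, so `m ≤ n + D.tA ≤ n + s` and finitely many `m`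
  -- suffice.
  refine hf m (Finset.mem_range.2 (by omega)) Γ ?_ ?_
  · rw [← (funext hrun : D.run = Γ)]
    exact hmem m D hD
  · exact Finset.mem_filter.2 ⟨Finset.mem_univ _, hm, hL, hcon⟩

/-- The overlap `tr (ω M)` of `M` with `ω`, as a linear functional of `M`. -/
def traceForm {Y : Type} [Fintype Y] (ω : Matrix Y Y ℂ) : Matrix Y Y ℂ →ₗ[ℂ] ℂ where
  toFun M := (ω * M).trace
  map_add' M N := by rw [Matrix.mul_add, Matrix.trace_add]
  map_smul' c M := by rw [Matrix.mul_smul, Matrix.trace_smul, RingHom.id_apply]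

theorem traceForm_proj {Y : Type} [Fintype Y] (ω : Matrix Y Y ℂ) (ψ : Y → ℂ) :
    traceForm ω (proj ψ) = overlap ψ ω := by
  change (ω * proj ψ).trace = _
  rw [proj, Matrix.mul_vecMulVec, Matrix.trace_vecMulVec, dotProduct_comm, overlap]

theorem traceForm_single {Y : Type} [Fintype Y] [DecidableEq Y] (ω : Matrix Y Y ℂ) (y : Y) :
    traceForm ω (Matrix.single y y 1) = ω y y := by
  change (ω * Matrix.single y y 1).trace = _
  simp [Matrix.trace_mul_single]

theorem sum_traceForm_single_le {X Y : Type} [Fintype X] [Fintype Y] [DecidableEq Y]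
    {ω : Matrix Y Y ℂ} (hω : ω.PosSemidef) {e : X → Y} (he : Function.Injective e) :
    ∑ x, (traceForm ω (Matrix.single (e x) (e x) 1)).re ≤ ω.trace.re := by
  simp only [traceForm_single, Matrix.trace, Complex.re_sum, Matrix.diag_apply]
  rw [← Finset.sum_image (f := fun y => (ω y y).re) (g := e) fun _ _ _ _ h => he h]
  exact Finset.sum_le_univ_sum_of_nonneg fun y => (Complex.le_def.1 hω.diag_nonneg).1

theorem epr_posSemidef (N : ℕ) : (epr N).PosSemidef := proj_posSemidef _

theorem eventually_exists_hardToDilute (G : GateSet) :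
    ∀ᶠ n : ℕ in atTop, ∃ f, IsHardToDilute G n f := by
  classical
  filter_upwards [eventually_circuitBound_lt G, eventually_ge_atTop 1] with n hn hn1
  set s := 2 ^ (n / 4) with hs
  choose S hS hmem using fun N => exists_finset_run G N N n n s
  let B : ∀ N, BiMap (Qubits N) (Qubits N) (Qubits n) (Qubits n) → Finset (Qubits n → Bool) :=
    fun N Γ => Finset.univ.filter fun f =>
      IsLOCC (Qubits n) (Qubits n) (Qubits N) (Qubits N) Γ ∧ dilErr Γ (localState n f) ≤ 1 / 10
  have hB : ∀ N Γ, ((B N Γ).card : ℝ) ≤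
      2 ^ Fintype.card (Qubits n) * Real.exp (-(Fintype.card (Qubits n) : ℝ) / 80) := by
    intro N Γ
    by_cases hg : IsLOCC (Qubits n) (Qubits n) (Qubits N) (Qubits N) Γ
    · have hω := hg.posSemidef _ (epr_posSemidef N)
      have ht : (Γ (epr N)).trace.re = 1 := by
        rw [hg.trace_eq, epr, trace_proj, eprVec_dotProduct_star, Complex.one_re]
      refine card_signState_ge_le (ℓ := traceForm (Γ (epr N))) attach_injective
        (fun ψ => ?_) (fun ψ => ?_) ?_ _ ?_
      · rw [traceForm_proj]
        exact overlap_nonneg ψ hω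
      · rw [traceForm_proj]
        simpa [ht] using overlap_le_trace ψ hω
      · refine (sum_traceForm_single_le hω attach_injective).trans ?_
        rw [ht, card_qubits]
        -- The trace of the form is at most one, hence at most half the dimension as soon as `n ≥
        -- 1`.
        have : (2 : ℝ) ≤ 2 ^ n := le_self_pow₀ (by norm_num) (by omega)
        push_cast
        linarith
      · intro f hf
        have he : 1 - fidelity (Γ (epr N)) (proj (signState (attach n) f)) ≤ 1 / 10 :=
          (Finset.mem_filter.1 hf).2.2
        rw [fidelity_proj hω (signState_dotProduct_star attach_injective f)] at he
        rw [traceForm_proj]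
        linarith
    · have : B N Γ = ∅ := Finset.filter_eq_empty_iff.2 fun f _ h => hg h.1
      rw [this, Finset.card_empty, Nat.cast_zero]
      positivity
  have hlt : ((n + s + 1 : ℕ) : ℝ) * circuitBound G (2 * n + 2 * s) s *
      Real.exp (-(Fintype.card (Qubits n) : ℝ) / 80) < 1 := by
    rw [card_qubits]
    push_cast at hn ⊢
    rw [neg_div, Real.exp_neg, ← div_eq_mul_inv, div_lt_one (Real.exp_pos _)]
    exact hn
  -- Input qubits do not count towards the size, so here the number of EPR pairs has to be
  -- restricted separately: `N ≤ s` bounds both the number of cases and the input length `2 * N`.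
  obtain ⟨f, hf⟩ := exists_not_mem_of_card_lt (X := Qubits n)
    (c := Real.exp (-(Fintype.card (Qubits n) : ℝ) / 80)) (M := ((n + s + 1 : ℕ) : ℝ))
    (K := circuitBound G (2 * n + 2 * s) s) (Finset.range (s + 1)) S B
    (Real.exp_pos _).le (Nat.cast_nonneg _)
    (by rw [Finset.card_range]; exact_mod_cast (by omega : s + 1 ≤ n + s + 1))
    (fun N hN => by
      have := Finset.mem_range.1 hN
      exact_mod_cast (hS N).trans (circuitBound_mono G (by omega))) hB hlt
  refine ⟨f, fun N Γ hN hΓ => ?_⟩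
  obtain ⟨hL, D, hD, hrun⟩ := hΓ
  by_contra! hcon
  refine hf N (Finset.mem_range.2 (by omega)) Γ ?_ ?_
  · rw [← (funext hrun : D.run = Γ)]
    exact hmem N D hD
  · exact Finset.mem_filter.2 ⟨Finset.mem_univ _, hL, hcon⟩

end HardStates

theorem HasCircuit.mono {G : GateSet} {nA nB mA mB : ℕ}
    {Γ : BiMap (Qubits nA) (Qubits nB) (Qubits mA) (Qubits mB)} {s t : ℕ}
    (h : HasCircuit G Γ s) (hst : s ≤ t) : HasCircuit G Γ t := by
  obtain ⟨hL, D, hD, hr⟩ := h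
  exact ⟨hL, D, hD.trans hst, hr⟩

end CompEnt

end

/-! ### The main theorem -/

theorem mainTheorem5 :
    ∃ ε₀ : ℝ, 0 < ε₀ ∧ ∀ (G : GateSet) (ε : ℝ), 0 < ε → ε ≤ ε₀ →
      ∀ n : ℕ+ → ℕ, Tendsto (fun k : ℕ+ => (n k : ℝ) / Real.log (k : ℝ)) atTop atTop →
        (∃ ρ : ∀ k, QState (Qubits (n k) × Qubits (n k)),
          (∀ k, (ρ k).IsPure ∧ oneShotED ε (ρ k) = (n k : ℕ∞) ∧
            entanglementEntropy (ρ k) = (n k : ℝ)) ∧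
          ∀ m : ℕ+ → ℕ, IsLowerBoundED G (fun _ => ε) ρ m → AsympLE m (fun _ => 0)) ∧
        (∃ σ : ∀ k, QState (Qubits (n k) × Qubits (n k)),
          (∀ k, (σ k).IsPure ∧ (σ k).IsProduct ∧ ∀ δ : ℝ, 0 ≤ δ → oneShotEC δ (σ k) = 0) ∧
          ∀ N : ℕ+ → ℕ, IsUpperBoundEC G (fun _ => ε) σ N →
            ∀ q : ℕ+ → ℕ, PolyBounded q → AsympLE q N) := by
  refine ⟨1 / 10, by norm_num, fun G ε h0 h1 n hn => ⟨?_, ?_⟩⟩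
  -- A hard pattern is chosen whenever one exists. For the remaining `k` any pattern will do,
  -- because the exact one-shot values hold for every `f`.
  · let f : ∀ k, Qubits (n k) → Bool := fun k => Classical.epsilon (IsHardToDistill G (n k))
    have hf : ∀ᶠ k in atTop, IsHardToDistill G (n k) (f k) :=
      ((tendsto_of_superlog hn).eventually (eventually_exists_hardToDistill G)).mono
        fun k hk => Classical.epsilon_spec hk
    refine ⟨fun k => phaseState (n k) (f k), fun k => ⟨⟨_, rfl⟩, oneShotED_phaseState _ h0 h1,
      entanglementEntropy_phaseState _⟩, ?_⟩
    rintro m ⟨Γ, ⟨p, hp⟩, hΓ⟩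
    refine eventually_atTop.1 ?_
    filter_upwards [hf, eventually_polynomial_le hn p] with k hk hpk
    by_contra! hm
    exact absurd (hk (m k) (Γ k) hm ((hp k).mono hpk)) (not_lt.2 ((hΓ k).trans h1))
  · let f : ∀ k, Qubits (n k) → Bool := fun k => Classical.epsilon (IsHardToDilute G (n k))
    have hf : ∀ᶠ k in atTop, IsHardToDilute G (n k) (f k) :=
      ((tendsto_of_superlog hn).eventually (eventually_exists_hardToDilute G)).mono
        fun k hk => Classical.epsilon_spec hk
    refine ⟨fun k => localState (n k) (f k), fun k => ⟨⟨_, rfl⟩, localState_isProduct _,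
      fun δ hδ => oneShotEC_localState _ hδ⟩, ?_⟩
    rintro N ⟨Γ, ⟨p, hp⟩, hΓ⟩ q ⟨r, hr⟩
    refine eventually_atTop.1 ?_
    filter_upwards [hf, eventually_polynomial_le hn p, eventually_polynomial_le hn r] with
      k hk hpk hrk
    by_contra! hN
    -- If `N k < q k`, then `N k` lies below the polynomial bound on `q`, hence in the range `N ≤ 2
    -- ^ (n / 4)` covered by hardness.
    exact absurd (hk (N k) (Γ k) (hN.le.trans ((hr k).trans hrk)) ((hp k).mono hpk))
      (not_lt.2 ((hΓ k).trans h1))
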